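/- Let $(W,S)$ be a Coxeter system of finite rank that is single braided, i.e. there is a natural number $k\ge 2$ (in particular $k\neq\infty$) such that $m(s,t)=k$ for all distinct $s,t\in S$. Assume that $(W,S)$ is infinite non-affine, i.e. not all connected components of its Coxeter graph (in which edges labelled $2$ are omitted) are of spherical or Euclidean type; here a connected component with vertex set $C$ is of spherical (respectively Euclidean) type if the Coxeter group it defines can be realised faithfully as a discrete group of isometries of a sphere (respectively of a Euclidean space) in which every generator $s\in C$ acts as a reflection in a hyperplane. Assume further that $(W,S)$ is not the single braided Coxeter system of rank $3$ with $k=4$. Let $R=\{usu^{-1} : u\in W,\ s\in S\}$ be the set of reflections, and for $x\in W$ let $l_R(x)$ be the least $q\geq 0$ such that $x$ is a product of $q$ elements of $R$. Let $w$ be any Coxeter element of $(W,S)$, i.e. a product of all elements of $S$, each occurring exactly once, in some order. Then the powers of $w$ have unbounded reflection length, in the sense that $$\lim_{\lambda\to\infty} l_R(w^\lambda)=\infty .$$ -/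

import Mathlib

noncomputable section

namespace CoxeterMatrix

variable {B : Type*} (M : CoxeterMatrix B)

/-- The Coxeter matrix obtained by restricting `M` to a set `s` of generators. -/
def restrictTo (s : Set B) : CoxeterMatrix s where
  M := Matrix.of fun i j : s => M i.1 j.1
  isSymm := Matrix.IsSymm.ext fun i j => M.symmetric j.1 i.1
  diagonal i := M.diagonal i.1
  off_diagonal i j h := M.off_diagonal i.1 j.1 fun h' => h (Subtype.ext h')

/-- The Coxeter graph, with the usual convention that edges labelled `2` are omitted.
Recall that the entry `0` of a Coxeter matrix encodes the label `∞`, which is an edge. -/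
def coxeterGraph : SimpleGraph B where
  Adj i j := i ≠ j ∧ M i j ≠ 2
  symm := ⟨fun i j h => ⟨h.1.symm, M.symmetric i j ▸ h.2⟩⟩
  loopless := ⟨fun _ h => h.1 rfl⟩

/-- Spherical type: the Coxeter group is (faithfully) a discrete group of isometries of a unit
sphere of some `ℝᵈ` whose standard generators are reflections in hyperplanes. The isometries of the
unit sphere are the linear isometries of `ℝᵈ`; they form a compact group, so that discrete means
finite. -/
def IsSphericalType : Prop :=
  ∃ (d : ℕ) (ρ : M.Group →* (EuclideanSpace ℝ (Fin d) ≃ₗᵢ[ℝ] EuclideanSpace ℝ (Fin d))),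
    Function.Injective ρ ∧
    (∀ i, ∃ v : EuclideanSpace ℝ (Fin d), v ≠ 0 ∧ ρ (M.simple i) = (ℝ ∙ v)ᗮ.reflection) ∧
    (Set.range ρ).Finite

/-- Euclidean type: the Coxeter group is (faithfully) a discrete group of isometries of some
Euclidean space `ℝᵈ` whose standard generators are reflections in affine hyperplanes. A group of
isometries of `ℝᵈ` is discrete iff every compact set meets only finitely many of its translates. -/
def IsEuclideanType : Prop :=
  ∃ (d : ℕ) (ρ : M.Group →* (EuclideanSpace ℝ (Fin d) ≃ᵃⁱ[ℝ] EuclideanSpace ℝ (Fin d))),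
    Function.Injective ρ ∧
    (∀ i, ∃ (H : AffineSubspace ℝ (EuclideanSpace ℝ (Fin d))) (_ : Nonempty H),
      Module.finrank ℝ H.direction + 1 = d ∧
        ρ (M.simple i) = EuclideanGeometry.reflection H) ∧
    ∀ K : Set (EuclideanSpace ℝ (Fin d)), IsCompact K →
      {g | g ∈ Set.range ρ ∧ (g '' K ∩ K).Nonempty}.Finite

/-- Infinite non-affine: not all connected components of the Coxeter graph are of spherical or
Euclidean type. -/
def IsInfiniteNonaffine : Prop :=
  ¬ ∀ c : M.coxeterGraph.ConnectedComponent,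
    (M.restrictTo c.supp).IsSphericalType ∨ (M.restrictTo c.supp).IsEuclideanType

/-- Single braided: all off-diagonal entries are equal to one and the same natural number
`k ≥ 2` (the label `∞`, encoded by `0`, is not allowed). -/
def IsSingleBraided : Prop :=
  ∃ k : ℕ, 2 ≤ k ∧ ∀ i j, i ≠ j → M i j = k

end CoxeterMatrix

namespace CoxeterSystem

variable {B : Type*} {W : Type*} [Group W] {M : CoxeterMatrix B} (cs : CoxeterSystem M W)

/-- A Coxeter element: the product of all standard generators, each taken once, in some order. -/
def IsCoxeterElement [Fintype B] (w : W) : Prop :=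
  ∃ σ : Fin (Fintype.card B) ≃ B, w = cs.wordProd (List.ofFn σ)

/-- Reflection length: the minimal number of factors in a factorisation into reflections (the set
of reflections is closed under inverses). -/
def reflectionLength (w : W) : ℕ :=
  sInf {n : ℕ | ∃ l : List W, l.length = n ∧ (∀ t ∈ l, cs.IsReflection t) ∧ l.prod = w}

/-- Every element is a product of reflections, so the infimum above is a minimum. -/
theorem exists_reflection_factorisation (w : W) :
    ∃ l : List W, l.length = cs.reflectionLength w ∧
      (∀ t ∈ l, cs.IsReflection t) ∧ l.prod = w := by
  have h : {n : ℕ | ∃ l : List W, l.length = n ∧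
      (∀ t ∈ l, cs.IsReflection t) ∧ l.prod = w}.Nonempty := by
    obtain ⟨u, rfl⟩ := cs.wordProd_surjective w
    refine ⟨_, u.map cs.simple, rfl, ?_, rfl⟩
    intro t ht
    obtain ⟨i, -, rfl⟩ := List.mem_map.1 ht
    exact cs.isReflection_simple i
  exact Nat.sInf_mem h

end CoxeterSystem

end

/-!
# Reflection length of powers of Coxeter elements

A Coxeter group acts by complex reflections on a Hermitian space whose form is the usual Gram
matrix with one entry twisted by the imaginary unit. On negative vectors of a Hermitian form with
one negative direction, the argument of the triple product is a bounded cocycle. It yields a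
quasimorphism that is bounded on reflections and grows linearly on the powers of every element
having a non-positive eigenvector whose eigenvalue is not a positive real number.
-/

/-! The real geometric representation is replaced by a complex one. `W` acts on `ℂⁿ`, with `n` the
rank, by reflections along the basis vectors of a Hermitian form with `1` on the diagonal and `-cos
(π / k)` elsewhere, except that the entry pairing the first and last factors of the Coxeter element
is multiplied by `I` (and its conjugate entry by `-I`). The dihedral relations see only the moduli
of the entries (`reflection_mul_reflection_pow_eq_one`), so this is still a representation. Outside
the spherical and affine cases the form has exactly one negative direction, and `W` acts on a
complex hyperbolic space.

The argument of the triple product (Cartan's angular invariant) is a cocycle. Based at a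
non-positive vector `u`, it lifts the action to pairs `(x, t)` with `t` real. The lift respects the
Coxeter relations because any two generating reflections fix a common negative vector, which
trivialises the cocycle on the dihedral group they generate. Every reflection moves `t` by at most
`π`. If `u` is an eigenvector of `w`, then `w` moves `t` by a constant `κ`, so `w ^ n` moves it by
`n * κ`, and `κ = 0` only if the eigenvalue is a positive real. Otherwise `l_R (w ^ n) ≥ n |κ| / π`
(`exists_linear_le_reflectionLength_pow`).

A non-positive eigenvector always exists (`exists_nonpos_eigenvector`). The twist is what keeps its
eigenvalue off the positive reals: the eigenvector equations of a Coxeter element are triangular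
(`prod_hermitianReflection_apply`), and for a positive eigenvalue they reduce to one scalar equation
whose coefficient has nonzero imaginary part (`eigenvalue_ne_of_nonpos`).

It remains to turn "infinite non-affine" into numbers. Components of rank at most two, and the
triangle with `k = 3`, are realised explicitly by reflections. This leaves rank and `k` at least
`3`, not both equal to `3` (`rank_and_label_bounds`), and then the twisted form has a negative
vector. -/

section ComplexHyperbolic

open Complex ComplexConjugate

/-! ### Hermitian forms with one negative direction, and Cartan's angular invariant. -/

section LorentzianForm

variable {V : Type*} [AddCommGroup V] [Module ℂ V]

/-- A Hermitian form which is positive definite on the orthogonal complement of every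
negative vector. -/
structure IsLorentzian (H : V →ₗ⋆[ℂ] V →ₗ[ℂ] ℂ) : Prop where
  conj_symm : ∀ x y, conj (H x y) = H y x
  pos_of_orthogonal : ∀ z x, (H z z).re < 0 → H z x = 0 → x ≠ 0 → 0 < (H x x).re

/-- A Hermitian form that is positive definite on the kernel of a linear functional is
Lorentzian. -/
theorem isLorentzian_of_pos_on_ker {H : V →ₗ⋆[ℂ] V →ₗ[ℂ] ℂ}
    (hH : ∀ x y, conj (H x y) = H y x) (l : V →ₗ[ℂ] ℂ)
    (hl : ∀ x, x ≠ 0 → l x = 0 → 0 < (H x x).re) : IsLorentzian H := by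
  refine ⟨hH, fun z x hz hzx hx => ?_⟩
  by_contra! hxx
  have hlz : l z ≠ 0 := by
    intro h
    have hz0 : z ≠ 0 := by rintro rfl; simp at hz
    linarith [hl z hz0 h]
  have hxz : H x z = 0 := by rw [← hH, hzx, map_zero]
  -- This combination lies in the kernel of `l`, while orthogonality of `z` and `x` makes its norm
  -- `|l x|² H z z + |l z|² H x x`, which is at most `0`.
  have hy : l x • z - l z • x = 0 := by
    by_contra hne
    have h1 := hl _ hne (by simp [mul_comm])
    have h2 : H (l x • z - l z • x) (l x • z - l z • x)
        = (normSq (l x) : ℂ) * H z z + (normSq (l z) : ℂ) * H x x := by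
      simp only [map_sub, LinearMap.sub_apply, map_smulₛₗ, LinearMap.smul_apply, smul_eq_mul,
        hzx, hxz, normSq_eq_conj_mul_self, RingHom.id_apply]
      ring
    rw [h2, add_re, re_ofReal_mul, re_ofReal_mul] at h1
    nlinarith [normSq_nonneg (l x), normSq_nonneg (l z)]
  have h3 : H z (l x • z - l z • x) = 0 := by rw [hy, map_zero]
  simp only [map_sub, map_smul, smul_eq_mul, hzx, mul_zero, sub_zero, mul_eq_zero] at h3
  rcases h3 with h3 | h3
  · rw [h3, zero_smul, zero_sub, neg_eq_zero, smul_eq_zero] at hy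
    exact hy.elim hlz hx
  · rw [h3] at hz; simp at hz

/-- The argument of the Hermitian triple product. -/
noncomputable def tripleArg (H : V →ₗ⋆[ℂ] V →ₗ[ℂ] ℂ) (x y z : V) : ℝ :=
  arg (-(H x y * H y z * H z x))

namespace IsLorentzian

variable {H : V →ₗ⋆[ℂ] V →ₗ[ℂ] ℂ} (hH : IsLorentzian H)
include hH

theorem normSq_apply (x y : V) : (normSq (H x y) : ℂ) = H x y * H y x := by
  rw [← mul_conj, hH.conj_symm]

theorem apply_ne_zero {x y : V} (hx : (H x x).re < 0) (hy0 : y ≠ 0) (hy : (H y y).re ≤ 0) :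
    H x y ≠ 0 := fun h => by linarith [hH.pos_of_orthogonal x y hx h hy0]

theorem apply_ne_zero' {x y : V} (hx : (H x x).re < 0) (hy0 : y ≠ 0) (hy : (H y y).re ≤ 0) :
    H y x ≠ 0 := fun h => hH.apply_ne_zero hx hy0 hy (by rw [← hH.conj_symm, h, map_zero])

/-- The combination of `x` and `y` orthogonal to `z` has non-negative norm. Expanding that norm
gives two non-positive diagonal terms, one of them strictly negative, minus twice the real part of
the triple product. Allowing `x` to be null matters because the base vector `u` may be null. -/
theorem triple_re_pos {x y z : V} (hx0 : x ≠ 0) (hx : (H x x).re ≤ 0) (hy : (H y y).re < 0)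
    (hz : (H z z).re < 0) : 0 < (-(H x y * H y z * H z x)).re := by
  have hw : H z (H z y • x - H z x • y) = 0 := by simp [mul_comm]
  have hnn : 0 ≤ (H (H z y • x - H z x • y) (H z y • x - H z x • y)).re := by
    by_cases h : H z y • x - H z x • y = 0
    · simp [h]
    · exact (hH.pos_of_orthogonal _ _ hz hw h).le
  have h2 : H (H z y • x - H z x • y) (H z y • x - H z x • y)
      = (normSq (H z y) : ℂ) * H x x + (normSq (H z x) : ℂ) * H y y
        - (H x y * H y z * H z x + conj (H x y * H y z * H z x)) := by
    simp only [map_sub, LinearMap.sub_apply, map_smulₛₗ, LinearMap.smul_apply, smul_eq_mul,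
      normSq_eq_conj_mul_self, hH.conj_symm, map_mul, RingHom.id_apply]
    ring
  rw [h2, sub_re, add_re, add_re, re_ofReal_mul, re_ofReal_mul, conj_re] at hnn
  have hy0 : y ≠ 0 := by rintro rfl; simp at hy
  have h3 : 0 < normSq (H z y) := normSq_pos.2 (hH.apply_ne_zero hz hy0 hy.le)
  have h4 : 0 < normSq (H z x) := normSq_pos.2 (hH.apply_ne_zero hz hx0 hx)
  rw [neg_re]
  nlinarith

end IsLorentzian

/-- All four arguments lie in `(-π/2, π/2)`, so sums of two do not wrap around and the identity is
exact, not merely modulo `2π`. -/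
theorem arg_add_arg_eq_of_re_pos {a b c d : ℂ} (ha : 0 < a.re) (hb : 0 < b.re) (hc : 0 < c.re)
    (hd : 0 < d.re) {r : ℝ} (hr : 0 < r) (h : a * b = r * (c * d)) :
    arg a + arg b = arg c + arg d := by
  have key : ∀ x y : ℂ, 0 < x.re → 0 < y.re → arg (x * y) = arg x + arg y := by
    intro x y hx hy
    have h1 := abs_lt.1 (abs_arg_lt_pi_div_two_iff.2 (Or.inl hx))
    have h2 := abs_lt.1 (abs_arg_lt_pi_div_two_iff.2 (Or.inl hy))
    refine arg_mul ?_ ?_ ?_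
    · rintro rfl; simp at hx
    · rintro rfl; simp at hy
    · constructor <;> linarith [h1.1, h1.2, h2.1, h2.2]
  rw [← key a b ha hb, h, arg_real_mul _ hr, key c d hc hd]

namespace IsLorentzian

variable {H : V →ₗ⋆[ℂ] V →ₗ[ℂ] ℂ} (hH : IsLorentzian H)
include hH

/-- The two products of triple products share all factors except `|H x z|²` on one side and `|H u
y|²` on the other, so they differ by a positive scalar. -/
theorem tripleArg_cocycle {u x y z : V} (hu0 : u ≠ 0) (hu : (H u u).re ≤ 0) (hx : (H x x).re < 0)
    (hy : (H y y).re < 0) (hz : (H z z).re < 0) :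
    tripleArg H x y z + tripleArg H u x z = tripleArg H u y z + tripleArg H u x y := by
  have hx0 : x ≠ 0 := by rintro rfl; simp at hx
  have hy0 : y ≠ 0 := by rintro rfl; simp at hy
  have hz0 : z ≠ 0 := by rintro rfl; simp at hz
  have hxz := normSq_pos.2 (hH.apply_ne_zero hx hz0 hz.le)
  have huy := normSq_pos.2 (hH.apply_ne_zero' hy hu0 hu)
  refine arg_add_arg_eq_of_re_pos (r := normSq (H x z) / normSq (H u y))
    (hH.triple_re_pos hx0 hx.le hy hz) (hH.triple_re_pos hu0 hu hx hz)
    (hH.triple_re_pos hu0 hu hy hz) (hH.triple_re_pos hu0 hu hx hy) (div_pos hxz huy) ?_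
  have huy' : (normSq (H u y) : ℂ) ≠ 0 := by exact_mod_cast huy.ne'
  push_cast
  field_simp
  rw [hH.normSq_apply, hH.normSq_apply]
  ring

end IsLorentzian

theorem tripleArg_smul (H : V →ₗ⋆[ℂ] V →ₗ[ℂ] ℂ) {u : V} (x y : V) {r : ℂ} (hr : r ≠ 0) :
    tripleArg H (r • u) x y = tripleArg H u x y := by
  have : -(H (r • u) x * H x y * H y (r • u))
      = (normSq r : ℝ) * -(H u x * H x y * H y u) := by
    simp only [map_smulₛₗ, LinearMap.smul_apply, smul_eq_mul, normSq_eq_conj_mul_self,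
      RingHom.id_apply]
    ring
  rw [tripleArg, this, arg_real_mul _ (normSq_pos.2 hr), tripleArg]

/-- The reflection along a vector `e` with `H e e = 1`. -/
noncomputable def hermitianReflection (H : V →ₗ⋆[ℂ] V →ₗ[ℂ] ℂ) (e : V) (he : H e e = 1) :
    V ≃ₗ[ℂ] V :=
  Module.reflection (x := e) (f := (2 : ℂ) • H e) (by simp [he])

theorem hermitianReflection_apply (H : V →ₗ⋆[ℂ] V →ₗ[ℂ] ℂ) (e : V) (he : H e e = 1) (x : V) :
    hermitianReflection H e he x = x - (2 * H e x) • e := by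
  simp [hermitianReflection, Module.reflection_apply]

namespace IsLorentzian

variable {H : V →ₗ⋆[ℂ] V →ₗ[ℂ] ℂ} (hH : IsLorentzian H)
include hH

theorem hermitianReflection_isometry {e : V} (he : H e e = 1) (x y : V) :
    H (hermitianReflection H e he x) (hermitianReflection H e he y) = H x y := by
  simp only [hermitianReflection_apply, map_sub, LinearMap.sub_apply, map_smulₛₗ,
    LinearMap.smul_apply, smul_eq_mul, RingHom.id_apply, he, map_mul, hH.conj_symm, map_ofNat]
  ring

theorem apply_hermitianReflection_self {e : V} (he : H e e = 1) (x : V) :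
    H x (hermitianReflection H e he x) = ((H x x).re - 2 * normSq (H e x) : ℝ) := by
  have : H x x = ((H x x).re : ℂ) := (conj_eq_iff_re.1 (hH.conj_symm x x)).symm
  push_cast
  rw [hermitianReflection_apply, map_sub, map_smul, ← this, hH.normSq_apply, smul_eq_mul]
  ring

/-- Here `H x (s x)` is a negative real and `p` is fixed by the reflection `s`, so the negated
triple product is a non-negative real. This vanishing makes the cocycle a coboundary on reflections.
-/
theorem tripleArg_hermitianReflection {e : V} (he : H e e = 1) {p x : V}
    (hp : (H p p).re < 0) (hpe : H e p = 0) (hx : (H x x).re < 0) :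
    tripleArg H p x (hermitianReflection H e he x) = 0 := by
  have hx0 : x ≠ 0 := by rintro rfl; simp at hx
  have hpx := normSq_pos.2 (hH.apply_ne_zero hp hx0 hx.le)
  have hep : H p e = 0 := by rw [← hH.conj_symm, hpe, map_zero]
  have h1 : H (hermitianReflection H e he x) p = H x p := by
    simp [hermitianReflection_apply, hpe]
  have h2 : -(H p x * H x (hermitianReflection H e he x) * H x p)
      = ((-((H x x).re - 2 * normSq (H e x)) * normSq (H p x) : ℝ) : ℂ) := by
    rw [hH.apply_hermitianReflection_self, ofReal_mul (-_), hH.normSq_apply]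
    push_cast
    ring
  rw [tripleArg, h1, h2, arg_ofReal_of_nonneg]
  have := normSq_nonneg (H e x)
  apply mul_nonneg <;> linarith

/-- Projecting a vector onto the orthogonal complement of a positive vector decreases its norm. -/
theorem exists_orthogonal_le {e : V} (he : 0 < (H e e).re) (x : V) :
    ∃ a : ℂ, H e (x - a • e) = 0 ∧ (H (x - a • e) (x - a • e)).re ≤ (H x x).re := by
  have hre : H e e = ((H e e).re : ℂ) := (conj_eq_iff_re.1 (hH.conj_symm e e)).symm
  have hne : H e e ≠ 0 := fun h => by rw [h] at he; simp at he
  have h0 : H e (x - (H e x / H e e) • e) = 0 := by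
    rw [map_sub, map_smul, smul_eq_mul, div_mul_cancel₀ _ hne, sub_self]
  refine ⟨H e x / H e e, h0, ?_⟩
  have h1 : H (x - (H e x / H e e) • e) (x - (H e x / H e e) • e)
      = H x x - ((normSq (H e x) / (H e e).re : ℝ) : ℂ) := by
    rw [LinearMap.map_sub₂, LinearMap.map_smulₛₗ₂, h0, smul_zero, sub_zero,
      map_sub, map_smul, smul_eq_mul]
    push_cast
    rw [← hre, hH.normSq_apply]
    ring
  rw [h1, sub_re, ofReal_re]
  have := div_nonneg (normSq_nonneg (H e x)) he.le
  linarith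

/-- The bound on `H e f` makes the span of `e` and `f` positive definite; Gram–Schmidt removes it
from `x` without increasing the norm. -/
theorem exists_neg_orthogonal_pair {e f x : V} (he : H e e = 1) (hf : H f f = 1)
    (hef : normSq (H e f) < 1) (hx : (H x x).re < 0) :
    ∃ p, (H p p).re < 0 ∧ H e p = 0 ∧ H f p = 0 := by
  obtain ⟨a, ha, ha'⟩ := hH.exists_orthogonal_le (e := e) (by simp [he]) x
  set p := x - a • e
  have hg : H (f - H e f • e) (f - H e f • e) = ((1 - normSq (H e f) : ℝ) : ℂ) := by
    push_cast
    rw [hH.normSq_apply]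
    simp only [map_sub, LinearMap.sub_apply, map_smulₛₗ, LinearMap.smul_apply, smul_eq_mul,
      hH.conj_symm, RingHom.id_apply, he, hf]
    ring
  have heg : H e (f - H e f • e) = 0 := by simp [he]
  obtain ⟨b, hb, hb'⟩ := hH.exists_orthogonal_le (e := f - H e f • e)
    (by rw [hg, ofReal_re]; linarith) p
  have h1 : H e (p - b • (f - H e f • e)) = 0 := by
    rw [map_sub, map_smul, heg, ha]; simp
  refine ⟨p - b • (f - H e f • e), by linarith, h1, ?_⟩
  rw [LinearMap.map_sub₂, LinearMap.map_smulₛₗ₂, h1, smul_zero, sub_zero] at hb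
  exact hb

/-- An invertible isometry has an eigenvector that is not positive as soon as there is some
nonzero vector which is not positive. -/
theorem exists_nonpos_eigenvector [FiniteDimensional ℂ V] (g : V ≃ₗ[ℂ] V)
    (hg : ∀ x y, H (g x) (g y) = H x y) {x : V} (hx0 : x ≠ 0) (hx : (H x x).re ≤ 0) :
    ∃ (u : V) (μ : ℂ), u ≠ 0 ∧ (H u u).re ≤ 0 ∧ g u = μ • u := by
  -- Induction on an invariant subspace containing a non-positive vector: a positive eigenvector is
  -- split off, its orthogonal complement is again invariant, and the projected vector stays nonzero
  -- and non-positive.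
  suffices h : ∀ (d : ℕ) (E : Submodule ℂ V), Module.finrank ℂ E = d → (∀ y ∈ E, g y ∈ E) →
      (∃ y ∈ E, y ≠ 0 ∧ (H y y).re ≤ 0) →
      ∃ (u : V) (μ : ℂ), u ≠ 0 ∧ (H u u).re ≤ 0 ∧ g u = μ • u from
    h _ ⊤ rfl (fun _ _ => trivial) ⟨x, trivial, hx0, hx⟩
  intro d
  induction d using Nat.strong_induction_on with
  | _ d ih =>
    rintro E hE hgE ⟨y, hyE, hy0, hy⟩
    have : Nontrivial E := ⟨⟨⟨y, hyE⟩, 0, fun h => hy0 (congrArg Subtype.val h)⟩⟩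
    obtain ⟨μ, hμ⟩ := Module.End.exists_eigenvalue (g.toLinearMap.restrict hgE)
    obtain ⟨⟨u, huE⟩, hu⟩ := hμ.exists_hasEigenvector
    have hu0 : u ≠ 0 := fun h => hu.2 (Subtype.ext h)
    have hgu : g u = μ • u := congrArg Subtype.val hu.apply_eq_smul
    by_cases hun : (H u u).re ≤ 0
    · exact ⟨u, μ, hu0, hun, hgu⟩
    push Not at hun
    have hμ0 : μ ≠ 0 := by
      rintro rfl
      rw [zero_smul] at hgu
      exact hu0 (g.injective (by rw [hgu, map_zero]))
    obtain ⟨a, ha, ha'⟩ := hH.exists_orthogonal_le hun y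
    refine ih _ ?_ (E ⊓ LinearMap.ker (H u)) rfl ?_ ⟨y - a • u, ⟨?_, ha⟩, ?_, ha'.trans hy⟩
    · rw [← hE]
      refine Submodule.finrank_lt_finrank_of_lt (lt_of_le_of_ne inf_le_left fun h => ?_)
      have : u ∈ E ⊓ LinearMap.ker (H u) := by rw [h]; exact huE
      have h0 : H u u = 0 := this.2
      rw [h0] at hun
      simp at hun
    · rintro z ⟨hzE, hz⟩
      refine ⟨hgE z hzE, ?_⟩
      have hz' : H u z = 0 := hz
      have h1 := hg u z
      rw [hgu, hz', map_smulₛₗ, LinearMap.smul_apply, smul_eq_mul, mul_eq_zero] at h1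
      exact h1.resolve_left (by simpa using hμ0)
    · exact E.sub_mem hyE (E.smul_mem a huE)
    · intro h
      have hya : y = a • u := sub_eq_zero.1 h
      have h2 : H y y = ((normSq a : ℝ) : ℂ) * H u u := by
        rw [hya]
        simp only [map_smulₛₗ, LinearMap.smul_apply, smul_eq_mul, normSq_eq_conj_mul_self,
          RingHom.id_apply]
        ring
      have ha0 : a ≠ 0 := by rintro rfl; exact hy0 (by rw [hya, zero_smul])
      rw [h2, re_ofReal_mul] at hy
      nlinarith [normSq_pos.2 ha0]

end IsLorentzian

end LorentzianForm

/-! ### Lifting isometries by the angular cocycle. -/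

section LiftedAction

variable {V : Type*} [AddCommGroup V] [Module ℂ V]

/-- An isometry of a Hermitian form acts on pairs of a negative vector and a real number; the
second component is a lift of the argument of the pairing with the reference vector `u`. -/
noncomputable def liftIsometry (H : V →ₗ⋆[ℂ] V →ₗ[ℂ] ℂ) (u : V) (g : V ≃ₗ[ℂ] V)
    (hg : ∀ x y, H (g x) (g y) = H x y) : Equiv.Perm ({x : V // (H x x).re < 0} × ℝ) where
  toFun q := (⟨g q.1, by rw [hg]; exact q.1.2⟩, q.2 + tripleArg H u q.1 (g q.1))
  invFun q := (⟨g.symm q.1, by rw [← hg, g.apply_symm_apply]; exact q.1.2⟩,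
    q.2 - tripleArg H u (g.symm q.1) q.1)
  left_inv q := by simp
  right_inv q := by simp

variable {H : V →ₗ⋆[ℂ] V →ₗ[ℂ] ℂ} (hH : IsLorentzian H) {u : V} (hu0 : u ≠ 0)
  (hu : (H u u).re ≤ 0)
include hH hu0 hu

/-- The cocycle identity for `u, p, x, s x` with its term at `p, x, s x` equal to zero. -/
theorem liftIsometry_reflection_snd {e : V} (he : H e e = 1) {p : V} (hp : (H p p).re < 0)
    (hpe : H e p = 0) (q : {x : V // (H x x).re < 0} × ℝ) :
    (liftIsometry H u (hermitianReflection H e he) (hH.hermitianReflection_isometry he) q).2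
      = q.2 + tripleArg H u p (hermitianReflection H e he q.1) - tripleArg H u p q.1 := by
  have h1 := hH.tripleArg_hermitianReflection he hp hpe q.1.2
  have h2 := hH.tripleArg_cocycle hu0 hu hp q.1.2
    (z := hermitianReflection H e he q.1)
    (by rw [hH.hermitianReflection_isometry]; exact q.1.2)
  simp only [liftIsometry, Equiv.coe_fn_mk]
  linarith

/-- Both reflections fix the same `p`, so their displacements are differences of one function,
`tripleArg H u p`, and telescope. Hence a relation between the two reflections lifts. -/
theorem liftIsometry_mul_pow {e f : V} (he : H e e = 1) (hf : H f f = 1) {p : V}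
    (hp : (H p p).re < 0) (hpe : H e p = 0) (hpf : H f p = 0) (m : ℕ)
    (q : {x : V // (H x x).re < 0} × ℝ) :
    (((liftIsometry H u (hermitianReflection H e he) (hH.hermitianReflection_isometry he) *
      liftIsometry H u (hermitianReflection H f hf) (hH.hermitianReflection_isometry hf)) ^ m) q).1
        = ((hermitianReflection H e he * hermitianReflection H f hf) ^ m) q.1.1 ∧
    (((liftIsometry H u (hermitianReflection H e he) (hH.hermitianReflection_isometry he) *
      liftIsometry H u (hermitianReflection H f hf) (hH.hermitianReflection_isometry hf)) ^ m) q).2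
        = q.2 + tripleArg H u p
          (((hermitianReflection H e he * hermitianReflection H f hf) ^ m) q.1.1)
          - tripleArg H u p q.1 := by
  induction m with
  | zero => simp
  | succ m ih =>
    rw [pow_succ', Equiv.Perm.mul_apply, Equiv.Perm.mul_apply, pow_succ', LinearEquiv.mul_apply,
      LinearEquiv.mul_apply]
    rw [liftIsometry_reflection_snd hH hu0 hu he hp hpe,
      liftIsometry_reflection_snd hH hu0 hu hf hp hpf, ih.2, ← ih.1]
    refine ⟨rfl, ?_⟩
    simp only [liftIsometry, Equiv.coe_fn_mk]
    ring

end LiftedAction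

/-! ### The displacement quasimorphism and the linear lower bound. -/

namespace CoxeterSystem

variable {V : Type*} [AddCommGroup V] [Module ℂ V]
  {B : Type*} {W : Type*} [Group W] {M : CoxeterMatrix B} (cs : CoxeterSystem M W)

/-- If a Coxeter group acts by reflections on a Lorentzian Hermitian space and an element `w` has
a non-positive eigenvector whose eigenvalue is not a positive real number, then the reflection
length of the powers of `w` grows linearly. -/
theorem exists_linear_le_reflectionLength_pow {H : V →ₗ⋆[ℂ] V →ₗ[ℂ] ℂ} (hH : IsLorentzian H)
    (e : B → V) (he : ∀ i, H (e i) (e i) = 1)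
    (hp : ∀ i j, ∃ p, (H p p).re < 0 ∧ H (e i) p = 0 ∧ H (e j) p = 0)
    (x₀ : V) (hx₀ : (H x₀ x₀).re < 0)
    (ρ : W →* (V ≃ₗ[ℂ] V)) (hρ : ∀ i, ρ (cs.simple i) = hermitianReflection H (e i) (he i))
    (w : W) {u : V} (hu0 : u ≠ 0) (hu : (H u u).re ≤ 0) {μ : ℂ} (hw : ρ w u = μ • u)
    (hμ : ∀ m : ℝ, 0 < m → μ ≠ m) :
    ∃ C : ℝ, 0 < C ∧ ∀ n : ℕ, C * n ≤ cs.reflectionLength (w ^ n) := by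
  have hlift : M.IsLiftable fun i => liftIsometry H u (hermitianReflection H (e i) (he i))
      (hH.hermitianReflection_isometry (he i)) := by
    intro i j
    obtain ⟨p, hpn, hpi, hpj⟩ := hp i j
    have hrel : (hermitianReflection H (e i) (he i) * hermitianReflection H (e j) (he j)) ^ M i j
        = 1 := by
      rw [← hρ, ← hρ, ← map_mul, ← map_pow, cs.simple_mul_simple_pow, map_one]
    ext1 q
    have h := liftIsometry_mul_pow hH hu0 hu (he i) (he j) hpn hpi hpj (M i j) q
    rw [hrel] at h
    exact Prod.ext (Subtype.ext h.1) (by simpa using h.2)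
  set τ := cs.lift ⟨_, hlift⟩ with hτ
  have hτs : ∀ i, τ (cs.simple i) = liftIsometry H u (hermitianReflection H (e i) (he i))
      (hH.hermitianReflection_isometry (he i)) := fun i => cs.lift_apply_simple hlift i
  have hiso : ∀ (g : W) (x y : V), H (ρ g x) (ρ g y) = H x y := by
    intro g
    induction g using cs.simple_induction_left with
    | one => simp
    | mul_simple_left g i ih =>
      intro x y
      rw [map_mul, LinearEquiv.mul_apply, LinearEquiv.mul_apply, hρ,
        hH.hermitianReflection_isometry, ih]
  have hfst : ∀ (g : W) q, ((τ g q).1 : V) = ρ g q.1 := by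
    intro g
    induction g using cs.simple_induction_left with
    | one => simp
    | mul_simple_left g i ih =>
      intro q
      rw [map_mul, map_mul, Equiv.Perm.mul_apply, LinearEquiv.mul_apply, ← ih, hτs, hρ]
      rfl
  -- How the displacement of `g` depends on the point. In the inductive step a negative `p` fixed by
  -- the simple reflection is used: `tripleArg H p` is unchanged by that reflection, so the cocycle
  -- identities before and after it can be compared.
  have hshift : ∀ (g : W) q q', (τ g q').2 - q'.2 - ((τ g q).2 - q.2)
      = tripleArg H u (ρ g q.1) (ρ g q'.1) - tripleArg H u q.1 q'.1 := by
    intro g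
    induction g using cs.simple_induction_left with
    | one => simp
    | mul_simple_left g i ih =>
      intro q q'
      obtain ⟨p, hpn, hpi, -⟩ := hp i i
      have hs := fun r => liftIsometry_reflection_snd hH hu0 hu (he i) hpn hpi r
      have h1 := ih q q'
      rw [map_mul, map_mul, Equiv.Perm.mul_apply, Equiv.Perm.mul_apply, LinearEquiv.mul_apply,
        LinearEquiv.mul_apply, hτs, hs, hs, hρ, ← hfst g, ← hfst g]
      rw [← hfst g, ← hfst g] at h1
      have hq := (τ g q).1.2
      have hq' := (τ g q').1.2
      set y : V := (τ g q).1.1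
      set y' : V := (τ g q').1.1
      have hfix : hermitianReflection H (e i) (he i) p = p := by
        simp [hermitianReflection_apply, hpi]
      have hI := hH.hermitianReflection_isometry (he i)
      have h2 := hH.tripleArg_cocycle hu0 hu hpn hq hq'
      have h3 := hH.tripleArg_cocycle hu0 hu hpn
        (y := hermitianReflection H (e i) (he i) y) (z := hermitianReflection H (e i) (he i) y')
        (by rwa [hI]) (by rwa [hI])
      have h4 : tripleArg H p (hermitianReflection H (e i) (he i) y)
          (hermitianReflection H (e i) (he i) y') = tripleArg H p y y' := by
        have := fun a => hI p a
        have h' := fun a => hI a p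
        rw [hfix] at this h'
        simp only [tripleArg, hI, this, h']
      linarith
  -- Modulo `2π` the displacement is the phase lost by the pairing with `u`; this is what detects
  -- the eigenvalue.
  have hphase : ∀ (g : W) q, ∃ r : ℝ, 0 < r ∧
      H u (ρ g q.1) * exp (((τ g q).2 - q.2 : ℝ) * I) = r * H u q.1 := by
    intro g
    induction g using cs.simple_induction_left with
    | one => exact fun q => ⟨1, one_pos, by simp⟩
    | mul_simple_left g i ih =>
      intro q
      obtain ⟨r, hr, h⟩ := ih q
      have hq := (τ g q).1.2
      rw [← hfst] at h
      rw [map_mul, map_mul, Equiv.Perm.mul_apply, LinearEquiv.mul_apply, ← hfst, hρ, hτs]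
      set y : V := (τ g q).1.1 with hy
      set s := hermitianReflection H (e i) (he i) with hs
      have hsy : (H (s y) (s y)).re < 0 := by rwa [hH.hermitianReflection_isometry]
      have h2 : (liftIsometry H u s (hH.hermitianReflection_isometry (he i)) (τ g q)).2
          = (τ g q).2 + tripleArg H u y (s y) := rfl
      set z := -(H u y * H y (s y) * H (s y) u) with hz
      have hz0 : 0 < z.re := hH.triple_re_pos hu0 hu hq hsy
      have hzn : 0 < ‖z‖ := norm_pos_iff.2 (by intro h0; rw [h0] at hz0; simp at hz0)
      set k : ℝ := -((H y y).re - 2 * normSq (H (e i) y)) with hk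
      have hkpos : 0 < k := by
        have := normSq_nonneg (H (e i) y)
        linarith
      have hpolar : (‖z‖ : ℂ) * exp (tripleArg H u y (s y) * I) = z := norm_mul_exp_arg_mul_I z
      have hz2 : z = k * H u y * H (s y) u := by
        rw [hz, hH.apply_hermitianReflection_self, hk]
        push_cast
        ring
      have hN := normSq_pos.2 (hH.apply_ne_zero' hsy hu0 hu)
      refine ⟨r * (k * normSq (H u (s y))) / ‖z‖, by positivity, ?_⟩
      have hzc : (‖z‖ : ℂ) ≠ 0 := by exact_mod_cast hzn.ne'
      have hexp : exp (((liftIsometry H u s (hH.hermitianReflection_isometry (he i)) (τ g q)).2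
          - q.2 : ℝ) * I) = exp (((τ g q).2 - q.2 : ℝ) * I) * exp (tripleArg H u y (s y) * I) := by
        rw [← Complex.exp_add, h2]
        push_cast
        ring_nf
      rw [hexp]
      push_cast
      rw [div_mul_eq_mul_div, eq_div_iff hzc]
      push_cast at h
      have hN' := hH.normSq_apply u (s y)
      linear_combination (H u (s y) * exp ((↑(τ g q).2 - ↑q.2) * I)) * hpolar
        + (H u (s y) * exp ((↑(τ g q).2 - ↑q.2) * I)) * hz2
        + k * H u (s y) * H (s y) u * h - r * k * H u q.1 * hN'
  -- For a simple reflection the displacement is a `tripleArg` by definition; `hshift` carries this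
  -- formula over to conjugates, and an argument is at most `π` in absolute value.
  have hrefl : ∀ t, cs.IsReflection t → ∀ q, |(τ t q).2 - q.2| ≤ Real.pi := by
    rintro t ⟨g, i, rfl⟩ q
    have h1 : (τ (g * cs.simple i * g⁻¹) q).2 - q.2
        = tripleArg H u q.1 (ρ (g * cs.simple i * g⁻¹) q.1) := by
      have h2 := hshift g (τ g⁻¹ q) (τ (cs.simple i) (τ g⁻¹ q))
      have h3 : (τ g (τ g⁻¹ q)) = q := by
        rw [← Equiv.Perm.mul_apply, ← map_mul, mul_inv_cancel, map_one]; rfl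
      have h4 : τ (g * cs.simple i * g⁻¹) q = τ g (τ (cs.simple i) (τ g⁻¹ q)) := by
        rw [map_mul, map_mul]; rfl
      have h5 : (τ (cs.simple i) (τ g⁻¹ q)).2 = (τ g⁻¹ q).2 + tripleArg H u (τ g⁻¹ q).1
          (τ (cs.simple i) (τ g⁻¹ q)).1 := by
        rw [hτs]; rfl
      rw [← hfst, ← hfst, h3, h5] at h2
      rw [← hfst, h4]
      linarith
    rw [h1]
    exact abs_arg_le_pi _
  have hprod : ∀ l : List W, (∀ t ∈ l, cs.IsReflection t) → ∀ q,
      |(τ l.prod q).2 - q.2| ≤ l.length * Real.pi := by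
    intro l
    induction l with
    | nil => simp
    | cons t l ih =>
      intro hl q
      have h1 := hrefl t (hl t (by simp)) (τ l.prod q)
      have h2 := ih (fun t ht => hl t (by simp [ht])) q
      rw [List.prod_cons, map_mul, Equiv.Perm.mul_apply, List.length_cons]
      push_cast
      rw [abs_le] at *
      constructor <;> linarith [h1.1, h1.2, h2.1, h2.2]
  have hμ0 : μ ≠ 0 := by
    rintro rfl
    rw [zero_smul] at hw
    exact hu0 ((ρ w).injective (by rw [hw, map_zero]))
  set q₀ : {x : V // (H x x).re < 0} × ℝ := (⟨x₀, hx₀⟩, 0) with hq₀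
  set κ := (τ w q₀).2 - q₀.2 with hκ
  -- Since `w` scales `u`, it preserves `tripleArg H u`, so the right-hand side of `hshift`
  -- vanishes.
  have hconst : ∀ q, (τ w q).2 - q.2 = κ := by
    intro q
    have h := hshift w q₀ q
    have h1 : tripleArg H u (ρ w q₀.1) (ρ w q.1) = tripleArg H u q₀.1 q.1 := by
      rw [← tripleArg_smul H _ _ hμ0, ← hw]
      simp only [tripleArg, hiso]
    linarith
  -- If `κ = 0`, then `H u (w x₀)` is a positive multiple `r` of `H u x₀`; invariance of `H` gives
  -- `conj μ * r = 1`, making `μ` a positive real.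
  have hκ0 : κ ≠ 0 := by
    intro h0
    obtain ⟨r, hr, h⟩ := hphase w q₀
    rw [← hκ, h0] at h
    simp only [ofReal_zero, zero_mul, Complex.exp_zero, mul_one] at h
    have h1 := hiso w u x₀
    rw [hw, map_smulₛₗ, LinearMap.smul_apply, smul_eq_mul] at h1
    change H u (ρ w x₀) = r * H u x₀ at h
    have h2 : (conj μ * r) * H u x₀ = 1 * H u x₀ := by
      rw [one_mul, mul_assoc, ← h]
      exact h1
    have h3 := mul_right_cancel₀ (hH.apply_ne_zero' hx₀ hu0 hu) h2
    have hr' : (r : ℂ) ≠ 0 := by exact_mod_cast hr.ne'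
    have h4 : conj μ = ((r⁻¹ : ℝ) : ℂ) := by
      rw [ofReal_inv]
      exact eq_inv_of_mul_eq_one_left h3
    refine hμ r⁻¹ (inv_pos.2 hr) ?_
    rw [← conj_conj μ, h4, conj_ofReal]
  have hpow : ∀ n : ℕ, (τ (w ^ n) q₀).2 - q₀.2 = n * κ := by
    intro n
    induction n with
    | zero => simp
    | succ n ih =>
      have h := hconst (τ (w ^ n) q₀)
      rw [pow_succ', map_mul, Equiv.Perm.mul_apply]
      push_cast
      linarith
  refine ⟨|κ| / Real.pi, div_pos (abs_pos.2 hκ0) Real.pi_pos, fun n => ?_⟩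
  obtain ⟨l, hl, hlr, hlp⟩ := cs.exists_reflection_factorisation (w ^ n)
  have h := hprod l hlr q₀
  rw [hlp, hpow, hl, abs_mul, Nat.abs_cast] at h
  rw [div_mul_eq_mul_div, div_le_iff₀ Real.pi_pos]
  linarith

end CoxeterSystem

/-! ### Dihedral relations between complex reflections. -/

theorem sin_two_pi_div_ne_zero {k : ℕ} (hk : 3 ≤ k) {φ : ℂ} (hφ : φ = 2 * Real.pi / k) :
    sin φ ≠ 0 := by
  have h : φ = ((2 * Real.pi / k : ℝ) : ℂ) := by rw [hφ]; push_cast; ring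
  rw [h, ← ofReal_sin, ofReal_ne_zero]
  have hk' : (3 : ℝ) ≤ k := by exact_mod_cast hk
  refine (Real.sin_pos_of_pos_of_lt_pi (by positivity) ?_).ne'
  rw [div_lt_iff₀ (by linarith)]
  nlinarith [Real.pi_pos]

/-- Two reflections whose linear forms satisfy `f y * g x = 4 cos² (π / k)` generate a dihedral
group of order dividing `2 k`. -/
theorem reflection_mul_reflection_pow_eq_one {V : Type*} [AddCommGroup V] [Module ℂ V]
    {x y : V} {f g : Module.Dual ℂ V} (hf : f x = 2) (hg : g y = 2) {k : ℕ} (hk : 3 ≤ k)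
    (hfg : f y * g x = 4 * cos (Real.pi / k) ^ 2) :
    (Module.reflection hf * Module.reflection hg) ^ k = 1 := by
  have hk0 : (k : ℂ) ≠ 0 := by exact_mod_cast (by omega : k ≠ 0)
  set φ : ℂ := 2 * Real.pi / k with hφ
  have hφk : φ * k = 2 * Real.pi := div_mul_cancel₀ _ hk0
  have hsin : sin φ ≠ 0 := sin_two_pi_div_ne_zero hk hφ
  have ht : 2 * cos φ = f y * g x - 2 := by
    have : φ = 2 * (Real.pi / k) := by rw [hφ]; ring
    rw [this, cos_two_mul, hfg]
    ring
  have hS : ∀ m : ℤ, (Polynomial.Chebyshev.S ℂ m).eval (2 * cos φ) * sin φ = sin ((m + 1) * φ) :=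
    Polynomial.Chebyshev.S_two_mul_complex_cos φ
  -- Up to the factor `sin φ`, the value of `S m` is `sin ((m + 1) φ)`. For `k = 2h`, `h φ = π`
  -- kills `S (h - 1)`; for `k = 2h + 1`, the angles `h φ` and `(h + 1) φ` add up to `2π`, so `S h +
  -- S (h - 1)` vanishes. Either way the correction terms in the power formula disappear.
  have key : (Polynomial.Chebyshev.S ℂ (((k : ℤ) - 2) / 2)).eval (2 * cos φ) = 0 ∧
      (Polynomial.Chebyshev.S ℂ (((k : ℤ) - 1) / 2)).eval (2 * cos φ) = 0 ∨
      (Polynomial.Chebyshev.S ℂ (((k : ℤ) - 1) / 2)).eval (2 * cos φ) +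
        (Polynomial.Chebyshev.S ℂ (((k : ℤ) - 3) / 2)).eval (2 * cos φ) = 0 ∧
      (Polynomial.Chebyshev.S ℂ ((k : ℤ) / 2)).eval (2 * cos φ) +
        (Polynomial.Chebyshev.S ℂ (((k : ℤ) - 2) / 2)).eval (2 * cos φ) = 0 := by
    rcases Nat.even_or_odd' k with ⟨h, rfl | rfl⟩
    · left
      have h0 : (Polynomial.Chebyshev.S ℂ ((h : ℤ) - 1)).eval (2 * cos φ) = 0 := by
        have := hS (h - 1)
        have h1 : (((h - 1 : ℤ) : ℂ) + 1) * φ = Real.pi := by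
          push_cast at hφk ⊢; linear_combination (1 / 2) * hφk
        rw [h1, sin_pi] at this
        exact (mul_eq_zero.1 this).resolve_right hsin
      constructor
      · rw [show (((2 * h : ℕ) : ℤ) - 2) / 2 = (h : ℤ) - 1 by omega, h0]
      · rw [show (((2 * h : ℕ) : ℤ) - 1) / 2 = (h : ℤ) - 1 by omega, h0]
    · right
      have h0 : (Polynomial.Chebyshev.S ℂ (h : ℤ)).eval (2 * cos φ) +
          (Polynomial.Chebyshev.S ℂ ((h : ℤ) - 1)).eval (2 * cos φ) = 0 := by
        have h1 := hS h
        have h2 := hS (h - 1)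
        have h3 : (((h : ℤ) : ℂ) + 1) * φ = 2 * Real.pi - (((h - 1 : ℤ) : ℂ) + 1) * φ := by
          push_cast at hφk ⊢; linear_combination hφk
        rw [h3, sin_sub, sin_two_pi, cos_two_pi, ← h2] at h1
        refine (mul_eq_zero.1 (?_ : _ * sin φ = 0)).resolve_right hsin
        linear_combination h1
      constructor
      · rw [show (((2 * h + 1 : ℕ) : ℤ) - 1) / 2 = (h : ℤ) by omega,
          show (((2 * h + 1 : ℕ) : ℤ) - 3) / 2 = (h : ℤ) - 1 by omega, h0]
      · rw [show (((2 * h + 1 : ℕ) : ℤ)) / 2 = (h : ℤ) by omega,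
          show (((2 * h + 1 : ℕ) : ℤ) - 2) / 2 = (h : ℤ) - 1 by omega, h0]
  ext z
  rw [Module.reflection_mul_reflection_pow_apply hf hg k z (2 * cos φ) ht]
  rcases key with ⟨h1, h2⟩ | ⟨h1, h2⟩
  · rw [h1, h2]; simp [LinearEquiv.coe_one]
  · rw [h1, h2]; simp [LinearEquiv.coe_one]

/-! ### The twisted Gram matrix. -/

section TwistedForm

/-- The Hermitian form on `ℂⁿ` with `1` on the diagonal and `-c` off the diagonal, except that the
entries relating the first and the last basis vector are twisted by `±I`. -/
noncomputable def twistedForm (N : ℕ) (c : ℝ) :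
    (Fin (N + 2) → ℂ) →ₗ⋆[ℂ] (Fin (N + 2) → ℂ) →ₗ[ℂ] ℂ :=
  LinearMap.mk₂'ₛₗ (starRingEnd ℂ) (RingHom.id ℂ)
    (fun x y => (1 + c) * ∑ i, conj (x i) * y i - c * (conj (∑ i, x i) * ∑ i, y i)
      + c * (1 - I) * (conj (x 0) * y (Fin.last _)) + c * (1 + I) * (conj (x (Fin.last _)) * y 0))
    (by intro x x' y; simp only [Pi.add_apply, map_add, Finset.sum_add_distrib, add_mul]; ring)
    (by
      intro a x y
      simp only [Pi.smul_apply, smul_eq_mul, map_mul, mul_assoc, ← Finset.mul_sum]; ring)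
    (by intro x y y'; simp only [Pi.add_apply, Finset.sum_add_distrib, mul_add]; ring)
    (by
      intro a x y
      simp only [Pi.smul_apply, smul_eq_mul, mul_left_comm _ a, ← Finset.mul_sum, RingHom.id_apply]
      ring)

variable {N : ℕ} {c : ℝ}

theorem twistedForm_apply (x y : Fin (N + 2) → ℂ) :
    twistedForm N c x y = (1 + c) * ∑ i, conj (x i) * y i - c * (conj (∑ i, x i) * ∑ i, y i)
      + c * (1 - I) * (conj (x 0) * y (Fin.last _))
      + c * (1 + I) * (conj (x (Fin.last _)) * y 0) := rfl

theorem twistedForm_single_apply (i : Fin (N + 2)) (y : Fin (N + 2) → ℂ) :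
    twistedForm N c (Pi.single i 1) y = (1 + c) * y i - c * ∑ j, y j
      + (if i = 0 then c * (1 - I) * y (Fin.last _) else 0)
      + (if i = Fin.last _ then c * (1 + I) * y 0 else 0) := by
  have h1 : ∑ j, conj ((Pi.single i 1 : Fin (N + 2) → ℂ) j) * y j = y i := by
    rw [Finset.sum_eq_single i] <;> simp +contextual
  rw [twistedForm_apply, h1]
  simp [Pi.single_apply, eq_comm]

theorem twistedForm_single_self (i : Fin (N + 2)) :
    twistedForm N c (Pi.single i 1) (Pi.single i 1) = 1 := by
  rw [twistedForm_single_apply]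
  have h : (0 : Fin (N + 2)) ≠ Fin.last _ := (Fin.last_pos).ne
  by_cases h1 : i = 0
  · subst h1; simp [h, h.symm]
  · by_cases h2 : i = Fin.last _
    · subst h2; simp [h, h.symm]
    · simp [h1, h2]

/-- The twist changes phases only, so for `c = cos (π / k)` the orders of products of two
reflections are unaffected. -/
theorem normSq_twistedForm_single {i j : Fin (N + 2)} (hij : i ≠ j) :
    normSq (twistedForm N c (Pi.single i 1) (Pi.single j 1)) = c ^ 2 := by
  rw [twistedForm_single_apply]
  have h : (0 : Fin (N + 2)) ≠ Fin.last _ := (Fin.last_pos).ne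
  simp only [Pi.single_apply, Finset.sum_ite_eq', Finset.mem_univ, if_true, hij, if_false]
  by_cases h1 : i = 0 <;> by_cases h2 : i = Fin.last _ <;> by_cases h3 : j = 0 <;>
    by_cases h4 : j = Fin.last _ <;> subst_vars <;>
    simp_all [normSq_apply, eq_comm] <;> try ring

theorem twistedForm_conj_symm (x y : Fin (N + 2) → ℂ) :
    conj (twistedForm N c x y) = twistedForm N c y x := by
  have h : conj (∑ i, conj (x i) * y i) = ∑ i, conj (y i) * x i := by
    rw [map_sum]
    exact Finset.sum_congr rfl fun i _ => by simp [mul_comm]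
  simp only [twistedForm_apply, map_add, map_sub, map_mul, h, conj_conj, map_one, conj_I,
    conj_ofReal]
  ring

/-- On vectors of coordinate sum zero the term `-c |∑ x i|²` drops out. A sum of four squares bounds
the twist below by `-2 c ∑ |x i|²`, leaving at least `(1 - c) ∑ |x i|²`. -/
theorem isLorentzian_twistedForm (hc : 0 ≤ c) (hc1 : c < 1) : IsLorentzian (twistedForm N c) := by
  refine isLorentzian_of_pos_on_ker twistedForm_conj_symm (∑ i, LinearMap.proj i) ?_
  intro x hx hlx
  have hsum : ∑ i, x i = 0 := by simpa using hlx
  have h1 : (twistedForm N c x x).re = (1 + c) * ∑ i, normSq (x i)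
      + 2 * c * ((x 0).re * (x (Fin.last _)).re + (x 0).im * (x (Fin.last _)).im
        + ((x 0).re * (x (Fin.last _)).im - (x 0).im * (x (Fin.last _)).re)) := by
    have : ∑ i, conj (x i) * x i = ((∑ i, normSq (x i) : ℝ) : ℂ) := by
      push_cast
      simp only [normSq_eq_conj_mul_self]
    rw [twistedForm_apply, hsum, this]
    simp
    ring
  have hA : normSq (x 0) + normSq (x (Fin.last _)) ≤ ∑ i, normSq (x i) := by
    rw [← Finset.sum_pair (f := fun i => normSq (x i)) (Fin.last_pos).ne]
    exact Finset.sum_le_sum_of_subset_of_nonneg (Finset.subset_univ _)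
      fun _ _ _ => normSq_nonneg _
  have hS : 0 < ∑ i, normSq (x i) := by
    obtain ⟨i, hi⟩ := Function.ne_iff.1 hx
    exact Finset.sum_pos' (fun _ _ => normSq_nonneg _) ⟨i, Finset.mem_univ _, normSq_pos.2 hi⟩
  rw [h1]
  simp only [normSq_apply (x 0), normSq_apply (x (Fin.last _))] at hA
  set S := ∑ i, normSq (x i)
  set p := (x 0).re
  set q := (x 0).im
  set r := (x (Fin.last _)).re
  set t := (x (Fin.last _)).im
  have h2 : 0 ≤ 2 * (p * r + q * t + (p * t - q * r)) + 2 * S := by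
    nlinarith [sq_nonneg (p + r), sq_nonneg (q + t), sq_nonneg (p + t), sq_nonneg (q - r)]
  nlinarith [mul_nonneg hc h2]

/-- A negative vector of the twisted form. -/
noncomputable def twistedNegVector (N : ℕ) : Fin (N + 2) → ℂ :=
  fun i => if i = 0 then 1 + I else if i = Fin.last _ then 1 - I else 1

/-- The phases of the end coordinates `1 ± I` turn the twisted entry into a real negative
contribution, while their pairings with the middle coordinates keep real part `-c`. -/
theorem twistedForm_negVector :
    (twistedForm N c (twistedNegVector N) (twistedNegVector N)).re
      = N + 4 - c * (N ^ 2 + 3 * N + 4) := by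
  have h : (0 : Fin (N + 2)) ≠ Fin.last _ := (Fin.last_pos).ne
  have h1 : ∑ i, twistedNegVector N i = N + 2 := by
    rw [Fin.sum_univ_succ, Fin.sum_univ_castSucc]
    simp [twistedNegVector, Fin.ext_iff, fun i : Fin N => i.2.ne]
    ring
  have h2 : ∑ i, conj (twistedNegVector N i) * twistedNegVector N i = N + 4 := by
    rw [Fin.sum_univ_succ, Fin.sum_univ_castSucc]
    simp [twistedNegVector, Fin.ext_iff, fun i : Fin N => i.2.ne]
    ring_nf
    rw [I_sq]
    ring
  rw [twistedForm_apply, h1, h2]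
  simp [twistedNegVector, h.symm]
  ring

end TwistedForm

/-! ### Eigenvectors of the Coxeter element. -/

section CoxeterEigenvector

theorem prod_hermitianReflection_apply_of_notMem {ι : Type*} [DecidableEq ι]
    {H : (ι → ℂ) →ₗ⋆[ℂ] (ι → ℂ) →ₗ[ℂ] ℂ}
    (hH : ∀ i, H (Pi.single i 1) (Pi.single i 1) = 1) {l : List ι} {j : ι} (hj : j ∉ l)
    (u : ι → ℂ) :
    (l.map fun i => hermitianReflection H (Pi.single i 1) (hH i)).prod u j = u j := by
  induction l with
  | nil => rfl
  | cons i l ih =>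
    rw [List.mem_cons, not_or] at hj
    rw [List.map_cons, List.prod_cons, LinearEquiv.mul_apply, hermitianReflection_apply,
      Pi.sub_apply, ih hj.2, Pi.smul_apply, Pi.single_eq_of_ne hj.1, smul_zero, sub_zero]

/-- The coordinates of the image of `u` under a product of all coordinate reflections of a
Hermitian form satisfy a triangular system of equations. -/
theorem prod_hermitianReflection_apply {n : ℕ}
    {H : (Fin n → ℂ) →ₗ⋆[ℂ] (Fin n → ℂ) →ₗ[ℂ] ℂ}
    (hH : ∀ i, H (Pi.single i 1) (Pi.single i 1) = 1) {u y : Fin n → ℂ}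
    (hy : ((List.finRange n).map fun i => hermitianReflection H (Pi.single i 1) (hH i)).prod u = y)
    (i : Fin n) : y i = u i - 2 * H (Pi.single i 1) (fun j => if i < j then y j else u j) := by
  set L := fun l : List (Fin n) =>
    (l.map fun i => hermitianReflection H (Pi.single i 1) (hH i)).prod with hL
  have hsplit : List.finRange n
      = (List.finRange n).take i ++ i :: (List.finRange n).drop (i + 1) := by
    have h := List.take_append_drop i (List.finRange n)
    rw [List.drop_eq_getElem_cons (by simp), List.getElem_finRange] at h
    exact h.symm
  have hmem₁ : ∀ j, j ∈ (List.finRange n).take i ↔ j < i := by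
    intro j
    rw [List.mem_take_iff_getElem]
    constructor
    · rintro ⟨m, hm, rfl⟩
      simp only [List.getElem_finRange, Fin.lt_def]
      simp at hm ⊢
      omega
    · intro hj
      exact ⟨j, by simpa using hj, by simp⟩
  have hmem₂ : ∀ j, j ∈ (List.finRange n).drop (i + 1) ↔ i < j := by
    intro j
    rw [List.mem_drop_iff_getElem]
    constructor
    · rintro ⟨m, hm, rfl⟩
      simp only [List.getElem_finRange, Fin.lt_def]
      simp at hm ⊢
      omega
    · intro hj
      refine ⟨j - (i + 1), ?_, ?_⟩
      · have := j.2; rw [Fin.lt_def] at hj; simp; omega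
      · rw [Fin.lt_def] at hj; ext; simp; omega
  set v := L ((List.finRange n).drop (i + 1)) u with hv
  have hy' : L ((List.finRange n).take i) (hermitianReflection H (Pi.single i 1) (hH i) v) = y := by
    rw [hsplit, List.map_append, List.prod_append, List.map_cons, List.prod_cons] at hy
    exact hy
  have hle : ∀ j, ¬ i < j → v j = u j := fun j hj =>
    prod_hermitianReflection_apply_of_notMem hH (by rwa [hmem₂]) u
  have hge : ∀ j, ¬ j < i → y j = hermitianReflection H (Pi.single i 1) (hH i) v j := fun j hj => by
    rw [← hy']
    exact prod_hermitianReflection_apply_of_notMem hH (by rwa [hmem₁]) _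
  -- The rightmost reflection acts first and each changes only its own coordinate: when reflection
  -- `i` acts, coordinates beyond `i` are final and the others untouched.
  have hvy : v = fun j => if i < j then y j else u j := by
    funext j
    split_ifs with hij
    · rw [hge j hij.not_gt, hermitianReflection_apply, Pi.sub_apply, Pi.smul_apply,
        Pi.single_eq_of_ne hij.ne', smul_zero, sub_zero]
    · exact hle j hij
  rw [← hvy, hge i (lt_irrefl i), hermitianReflection_apply, Pi.sub_apply, Pi.smul_apply,
    Pi.single_eq_same, hle i (lt_irrefl i), smul_eq_mul, mul_one]

/-- Eliminating `a` and `b` leaves a complex multiple of `s` equal to zero. Its imaginary part,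
which is due to the twist, is `-4 c² μ (R - 1)`, nonzero because `R ≠ 1`. In the application `a` and
`b` are the end coordinates and `m * s` is the sum of the middle ones. -/
theorem eq_zero_of_eigenvector_system {c μ R : ℝ} (hc : 0 < c) (hμ : 0 < μ)
    (hμ1 : μ ≠ 1) (hR : R ≠ 1) {a b s : ℂ}
    (hA : 2 * c * s = (1 + μ + 2 * c) * a + 2 * c * (1 - I) * μ * b)
    (hB : 2 * c * R * s = (1 + μ + 2 * c * μ) * b + 2 * c * (1 + I) * a)
    (hC : μ * R * s - s = (μ - 1) * (a + μ * b)) : s = 0 := by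
  have hμ1' : 1 - μ ≠ 0 := sub_ne_zero.2 hμ1.symm
  obtain ⟨m, hm⟩ : ∃ m, m * (1 - μ) = R - 1 := ⟨(R - 1) / (1 - μ), div_mul_cancel₀ _ hμ1'⟩
  have hmc : (m : ℂ) * (1 - μ) = R - 1 := by exact_mod_cast hm
  have hm0 : m ≠ 0 := by
    rintro rfl
    rw [zero_mul] at hm
    exact hR (sub_eq_zero.1 hm.symm)
  have hμc : (1 - μ : ℂ) ≠ 0 := by exact_mod_cast hμ1'
  have hs : s = a + μ * m * s + μ * b := by
    refine mul_left_cancel₀ hμc ?_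
    linear_combination -hC - μ * s * hmc
  have hA' : (1 + μ) * a = 2 * c * μ * (m * s + I * b) := by
    linear_combination -hA + 2 * c * hs
  have hB' : (1 + μ) * b = 2 * c * (m * s - I * a) := by
    linear_combination -hB - 2 * c * s * hmc + 2 * c * hs
  have hP : ((1 + μ) ^ 2 - 4 * c ^ 2 * μ : ℂ) * (a + μ * b)
      = 2 * c * μ * m * (2 * (1 + μ) + 2 * c * (1 - μ) * I) * s := by
    linear_combination (1 + μ - 2 * c * μ * I) * hA' + (μ * (1 + μ) + 2 * c * μ * I) * hB'
      - (4 * c ^ 2 * μ * (a + μ * b)) * I_sq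
  have hP' : ((((1 + μ) ^ 2 - 4 * c ^ 2 * μ) * (1 - μ * m) - 2 * c * μ * m * (2 * (1 + μ)) : ℝ)
      - (4 * c ^ 2 * μ * m * (1 - μ) : ℝ) * I : ℂ) * s = 0 := by
    push_cast
    linear_combination hP + ((1 + μ) ^ 2 - 4 * c ^ 2 * μ) * hs
  refine (mul_eq_zero.1 hP').resolve_left fun h => ?_
  have him := congrArg im h
  simp only [sub_im, ofReal_im, mul_im, ofReal_re, I_im, I_re, zero_im, mul_zero, mul_one,
    add_zero, zero_sub, neg_eq_zero] at him
  have : 4 * c ^ 2 * μ * m * (1 - μ) ≠ 0 := by positivity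
  exact this him

/-- The product of all coordinate reflections of the twisted form has no non-positive eigenvector
with a positive real eigenvalue. -/
theorem eigenvalue_ne_of_nonpos {N : ℕ} (hN : 1 ≤ N) {c : ℝ} (hc : 0 < c) (hc1 : c < 1)
    (hneg : (N + 4 - c * (N ^ 2 + 3 * N + 4) : ℝ) < 0)
    {u : Fin (N + 2) → ℂ} (hu0 : u ≠ 0) (hu : (twistedForm N c u u).re ≤ 0) {μ : ℝ} (hμ : 0 < μ)
    (h : ((List.finRange (N + 2)).map fun i => hermitianReflection (twistedForm N c)
      (Pi.single i 1) (twistedForm_single_self i)).prod u = (μ : ℂ) • u) : False := by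
  have key := prod_hermitianReflection_apply twistedForm_single_self h
  have hL := isLorentzian_twistedForm (N := N) hc.le hc1
  -- A fixed vector lies in the radical of the form, hence is orthogonal to a negative vector and
  -- would have to be positive.
  by_cases hμ1 : μ = 1
  · subst hμ1
    have h0 : ∀ i, twistedForm N c (Pi.single i 1) u = 0 := by
      intro i
      have := key i
      simp only [ofReal_one, one_smul, ite_self] at this
      linear_combination (1 / 2) * this
    have hx := hL.pos_of_orthogonal (twistedNegVector N) u (by rwa [twistedForm_negVector])
    have h1 : twistedForm N c (twistedNegVector N) u = 0 := by
      rw [pi_eq_sum_univ' (twistedNegVector N)]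
      simp only [map_sum, map_smulₛₗ, LinearMap.sum_apply, LinearMap.smul_apply]
      refine Finset.sum_eq_zero fun i _ => ?_
      rw [h0, smul_zero]
    linarith [hx h1 hu0]
  have hlast : (0 : Fin (N + 2)) ≠ Fin.last _ := (Fin.last_pos).ne
  have hμc : (1 - μ : ℂ) ≠ 0 := by
    rw [sub_ne_zero]; exact_mod_cast (Ne.symm hμ1)
  have hcc : (c : ℂ) ≠ 0 := by exact_mod_cast hc.ne'
  -- `S i` is the coordinate sum of the intermediate vector on which reflection `i` acts. The middle
  -- equations make `S` a geometric progression with ratio `r`, so only `S 0` and the two end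
  -- coordinates remain unknown.
  obtain ⟨S, hS⟩ : ∃ S : Fin (N + 2) → ℂ, ∀ i, S i = ∑ j, if i < j then (μ : ℂ) * u j else u j :=
    ⟨_, fun _ => rfl⟩
  obtain ⟨T, hT⟩ : ∃ T, T = ∑ j, u j := ⟨_, rfl⟩
  have hstep : ∀ i : Fin (N + 1), S i.succ - S i.castSucc = (1 - μ) * u i.succ := by
    intro i
    rw [hS, hS, ← Finset.sum_sub_distrib, Finset.sum_eq_single i.succ]
    · simp
      ring
    · intro j _ hj
      have : i.succ < j ↔ i.castSucc < j := by
        simp only [Fin.lt_def, Fin.ext_iff, Fin.val_succ, Fin.val_castSucc, ne_eq] at hj ⊢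
        omega
      simp [this]
    · simp
  have hS0 : S 0 = (1 - μ) * u 0 + μ * T := by
    rw [hS, hT, Fin.sum_univ_succ, Fin.sum_univ_succ (f := u)]
    simp only [lt_irrefl, if_false, Fin.succ_pos, if_true, ← Finset.mul_sum]
    ring
  have hSl : S (Fin.last _) = T := by
    rw [hS, hT]
    exact Finset.sum_congr rfl fun j _ => if_neg (Fin.le_last j).not_gt
  have e0 := key 0
  have el := key (Fin.last _)
  have em : ∀ i, i ≠ 0 → i ≠ Fin.last _ → 2 * c * S i = (1 + μ + 2 * c) * u i := by
    intro i h0 hl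
    have := key i
    rw [twistedForm_single_apply] at this
    simp only [h0, hl, if_false, lt_irrefl, Pi.smul_apply, smul_eq_mul, ← hS] at this
    linear_combination -this
  rw [twistedForm_single_apply] at e0 el
  simp only [hlast, hlast.symm, if_false, lt_irrefl, Pi.smul_apply, smul_eq_mul, if_true,
    Fin.last_pos, Fin.not_lt_zero, ← hS] at e0 el
  rw [hSl] at el
  have hd : 0 < 1 + μ + 2 * c * μ := by positivity
  have hdc : (1 + μ + 2 * c * μ : ℂ) ≠ 0 := by exact_mod_cast hd.ne'
  set r : ℝ := (1 + μ + 2 * c) / (1 + μ + 2 * c * μ) with hr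
  have hrc : (r : ℂ) * (1 + μ + 2 * c * μ) = 1 + μ + 2 * c := by
    exact_mod_cast div_mul_cancel₀ _ hd.ne'
  have hchain : ∀ k (hk : k ≤ N), S ⟨k, by omega⟩ = (r : ℂ) ^ k * S 0 := by
    intro k
    induction k with
    | zero => intro _; simp
    | succ k ih =>
      intro hk
      have h1 := hstep ⟨k, by omega⟩
      have h2 := em ⟨k + 1, by omega⟩ (by simp [Fin.ext_iff]) (by simp [Fin.ext_iff]; omega)
      rw [Fin.succ_mk, Fin.castSucc_mk, ih (by omega)] at h1
      rw [pow_succ]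
      refine mul_left_cancel₀ hdc (mul_left_cancel₀ (mul_ne_zero two_ne_zero hcc) ?_)
      linear_combination 2 * c * (1 + μ + 2 * c) * h1 + 2 * c * (r ^ k * S 0) * (-hrc)
        + (- 2 * c * (1 - μ)) * h2
  have hR1 : r ^ N ≠ 1 := by
    intro h1
    rw [pow_eq_one_iff_of_nonneg (by positivity) (by omega), hr, div_eq_one_iff_eq hd.ne'] at h1
    have : 2 * c * (1 - μ) = 0 := by linarith
    rcases mul_eq_zero.1 this with h2 | h2
    · linarith
    · exact hμ1 (by linarith)
  have hSN := hchain N le_rfl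
  have hTN := hstep (Fin.last N)
  rw [Fin.succ_last, hSl, show (Fin.last N).castSucc = (⟨N, by omega⟩ : Fin (N + 2)) from rfl,
    hSN] at hTN
  have hA : 2 * c * S 0 = (1 + μ + 2 * c) * u 0 + 2 * c * (1 - I) * μ * u (Fin.last _) := by
    linear_combination -e0
  have hC : μ * (r ^ N : ℝ) * S 0 - S 0 = (μ - 1) * (u 0 + μ * u (Fin.last _)) := by
    push_cast
    linear_combination -μ * hTN - hS0
  have hz : S 0 = 0 := by
    refine eq_zero_of_eigenvector_system hc hμ hμ1 hR1 hA ?_ hC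
    push_cast
    linear_combination -el - 2 * c * hTN
  have hab : u 0 + μ * u (Fin.last _) = 0 := by
    rw [hz] at hC
    refine mul_left_cancel₀ hμc ?_
    linear_combination hC
  have ha : u 0 = 0 := by
    have h1 : (1 + μ + 2 * c * I) * u 0 = 0 := by
      linear_combination -hA + 2 * c * hz - 2 * c * (1 - I) * hab
    refine (mul_eq_zero.1 h1).resolve_left fun h2 => ?_
    have := congrArg re h2
    simp at this
    linarith
  have hb : u (Fin.last _) = 0 := by
    rw [ha, zero_add] at hab
    exact (mul_eq_zero.1 hab).resolve_left (by exact_mod_cast hμ.ne')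
  refine hu0 (funext fun i => ?_)
  by_cases h0 : i = 0
  · rw [h0, ha]; rfl
  by_cases hl : i = Fin.last _
  · rw [hl, hb]; rfl
  have h1 := em i h0 hl
  have hi : (i : ℕ) ≤ N := by
    have := i.2
    have : (i : ℕ) ≠ N + 1 := fun h => hl (Fin.ext h)
    omega
  rw [hchain i hi, hz, mul_zero, mul_zero] at h1
  refine (mul_eq_zero.1 h1.symm).resolve_left ?_
  exact_mod_cast (by positivity : 1 + μ + 2 * c ≠ 0)

end CoxeterEigenvector

/-! ### Linear growth for Coxeter elements. -/

namespace CoxeterSystem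

variable {B : Type*} {W : Type*} [Group W] {M : CoxeterMatrix B} (cs : CoxeterSystem M W)

/-- The reflection length of the powers of a Coxeter element grows linearly as soon as the twisted
form takes a negative value. -/
theorem exists_linear_le_reflectionLength_coxeterElement_pow {N k : ℕ} (hN : 1 ≤ N) (hk : 3 ≤ k)
    (hM : ∀ i j, i ≠ j → M i j = k)
    (hneg : (N + 4 - Real.cos (Real.pi / k) * (N ^ 2 + 3 * N + 4) : ℝ) < 0)
    (σ : Fin (N + 2) ≃ B) :
    ∃ C : ℝ, 0 < C ∧ ∀ n : ℕ,
      C * n ≤ cs.reflectionLength (cs.wordProd (List.ofFn σ) ^ n) := by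
  have hk' : (3 : ℝ) ≤ k := by exact_mod_cast hk
  have hpos : 0 < Real.pi / k := div_pos Real.pi_pos (by linarith)
  have hlt : Real.pi / k < Real.pi / 2 :=
    div_lt_div_of_pos_left Real.pi_pos (by norm_num) (by linarith)
  set c := Real.cos (Real.pi / k) with hc
  have hc0 : 0 < c := Real.cos_pos_of_mem_Ioo ⟨by linarith, hlt⟩
  have hc1 : c < 1 := by
    rw [hc, ← Real.cos_zero]
    exact Real.cos_lt_cos_of_nonneg_of_le_pi_div_two le_rfl hlt.le hpos
  have hc2 : c ^ 2 < 1 := by nlinarith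
  have hL := isLorentzian_twistedForm (N := N) hc0.le hc1
  set e : B → (Fin (N + 2) → ℂ) := fun b => Pi.single (σ.symm b) 1 with he
  have hee : ∀ b, twistedForm N c (e b) (e b) = 1 := fun b => twistedForm_single_self _
  have hx₀ : (twistedForm N c (twistedNegVector N) (twistedNegVector N)).re < 0 := by
    rwa [twistedForm_negVector]
  have hnsq : ∀ i j, i ≠ j → normSq (twistedForm N c (e i) (e j)) = c ^ 2 := fun i j hij =>
    normSq_twistedForm_single (σ.symm.injective.ne hij)
  have hp : ∀ i j, ∃ p, (twistedForm N c p p).re < 0 ∧ twistedForm N c (e i) p = 0 ∧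
      twistedForm N c (e j) p = 0 := by
    intro i j
    by_cases hij : i = j
    · subst hij
      obtain ⟨a, ha, ha'⟩ := hL.exists_orthogonal_le (e := e i) (by simp [hee])
        (twistedNegVector N)
      exact ⟨_, ha'.trans_lt hx₀, ha, ha⟩
    · exact hL.exists_neg_orthogonal_pair (hee i) (hee j) (by rwa [hnsq i j hij]) hx₀
  have hlift : M.IsLiftable fun b => hermitianReflection (twistedForm N c) (e b) (hee b) := by
    intro i j
    by_cases hij : i = j
    · subst hij
      rw [M.diagonal, pow_one]
      ext1 x
      exact Module.involutive_reflection (by simp [hee]) x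
    · rw [hM i j hij]
      refine reflection_mul_reflection_pow_eq_one _ _ hk ?_
      have h1 := hL.normSq_apply (e i) (e j)
      rw [hnsq i j hij, hc] at h1
      push_cast at h1
      simp only [LinearMap.smul_apply, smul_eq_mul]
      linear_combination -4 * h1
  set ρ := cs.lift ⟨_, hlift⟩
  have hρ : ∀ b, ρ (cs.simple b) = hermitianReflection (twistedForm N c) (e b) (hee b) :=
    fun b => cs.lift_apply_simple hlift b
  have hρw : ρ (cs.wordProd (List.ofFn σ)) = ((List.finRange (N + 2)).map fun i =>
      hermitianReflection (twistedForm N c) (Pi.single i 1) (twistedForm_single_self i)).prod := by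
    rw [wordProd, map_list_prod, List.map_map, List.ofFn_eq_map, List.map_map]
    congr 1
    refine List.map_congr_left fun i _ => ?_
    simp only [Function.comp_apply, hρ]
    congr 1
    simp [he]
  have hiso : ∀ (g : W) x y, twistedForm N c (ρ g x) (ρ g y) = twistedForm N c x y := by
    intro g
    induction g using cs.simple_induction_left with
    | one => simp
    | mul_simple_left g i ih =>
      intro x y
      rw [map_mul, LinearEquiv.mul_apply, LinearEquiv.mul_apply, hρ,
        hL.hermitianReflection_isometry, ih]
  have hx0 : twistedNegVector N ≠ 0 := by
    intro h
    rw [h] at hx₀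
    simp at hx₀
  obtain ⟨u, μ, hu0, hu, hw⟩ := hL.exists_nonpos_eigenvector
    (ρ (cs.wordProd (List.ofFn σ))) (hiso _) hx0 hx₀.le
  refine cs.exists_linear_le_reflectionLength_pow hL e hee hp _ hx₀ ρ hρ _ hu0 hu hw ?_
  rintro m hm rfl
  rw [hρw] at hw
  exact eigenvalue_ne_of_nonpos hN hc0 hc1 hneg hu0 hu hm hw

end CoxeterSystem

/-! ### Rank one and finite dihedral systems are spherical. -/

namespace CoxeterMatrix

variable {B : Type*} (M : CoxeterMatrix B)

/-- A Coxeter matrix of rank one is of spherical type. -/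
theorem isSphericalType_of_subsingleton {i : B} (hi : ∀ j, j = i) : M.IsSphericalType := by
  set v : EuclideanSpace ℝ (Fin 1) := EuclideanSpace.single 0 1 with hv
  have hv0 : v ≠ 0 := by
    intro h
    have := congrArg (fun x => x 0) h
    simp [hv] at this
  have hlift : M.IsLiftable fun _ : B => ((ℝ ∙ v)ᗮ).reflection := by
    intro a b
    rw [hi a, hi b, Submodule.reflection_mul_reflection, one_pow]
  set cs := M.toCoxeterSystem
  have hs : ∀ j, cs.lift ⟨_, hlift⟩ (cs.simple j) = ((ℝ ∙ v)ᗮ).reflection :=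
    fun j => cs.lift_apply_simple hlift j
  have hall : ∀ g : M.Group, g = 1 ∨ g = cs.simple i := by
    intro g
    induction g using cs.simple_induction_left with
    | one => exact Or.inl rfl
    | mul_simple_left g j ih =>
      rw [hi j]
      rcases ih with rfl | rfl
      · exact Or.inr (mul_one _)
      · exact Or.inl (cs.simple_mul_simple_self i)
  refine ⟨1, cs.lift ⟨_, hlift⟩, (injective_iff_map_eq_one _).2 fun g hg => ?_,
    fun j => ⟨v, hv0, hs j⟩, ?_⟩
  · refine (hall g).resolve_right ?_
    rintro rfl
    rw [hs] at hg
    have h1 := Submodule.reflection_orthogonalComplement_singleton_eq_neg (𝕜 := ℝ) v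
    rw [hg] at h1
    have h2 := congrArg (fun x => x 0) h1
    simp only [LinearIsometryEquiv.coe_one, id, hv] at h2
    norm_num at h2
  · have : Finite M.Group :=
      Set.finite_univ_iff.1 (((Set.finite_singleton (cs.simple i)).insert 1).subset
        fun g _ => hall g)
    exact Set.finite_range _

theorem reflection_orthogonal_span_complex {E : Type*} [NormedAddCommGroup E]
    [InnerProductSpace ℝ E] (L : ℂ ≃ₗᵢ[ℝ] E) {v : ℂ} (hv : ‖v‖ = 1) (z : ℂ) :
    ((ℝ ∙ L v)ᗮ).reflection (L z) = L (-v ^ 2 * conj z) := by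
  rw [Submodule.reflection_orthogonal_apply, Submodule.reflection_singleton_apply, L.norm_map, hv,
    L.inner_map_map, ← map_smul, ← map_nsmul, ← map_sub, ← map_neg]
  congr 1
  have h1 : v * conj v = 1 := by rw [mul_conj, normSq_eq_norm_sq, hv]; norm_num
  have h2 : ((inner ℝ v z : ℝ) : ℂ) = (z * conj v + conj z * v) / 2 := by
    rw [Complex.inner, re_eq_add_conj, map_mul, conj_conj]
  simp only [RCLike.ofReal_real_eq_id, id, one_pow, div_one, real_smul, nsmul_eq_mul, h2]
  push_cast
  linear_combination -z * h1

/-- Finite dihedral Coxeter matrices are of spherical type. -/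
theorem isSphericalType_of_pair {i j : B} (hij : i ≠ j) (hall : ∀ l, l = i ∨ l = j) {k : ℕ}
    (hk : 2 ≤ k) (hM : M i j = k) : M.IsSphericalType := by
  classical
  obtain ⟨L⟩ : Nonempty (ℂ ≃ₗᵢ[ℝ] EuclideanSpace ℝ (Fin 2)) :=
    ⟨Complex.orthonormalBasisOneI.repr⟩
  set ζ := exp (2 * Real.pi * I / k) with hζ
  have hprim : IsPrimitiveRoot ζ k := Complex.isPrimitiveRoot_exp k (by omega)
  -- Unit normals at angle `π / k`. Reflecting along `v` is `z ↦ -v² * conj z`, so the product of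
  -- the two reflections is multiplication by `conj ζ`, of exact order `k`.
  set v : B → ℂ := fun l => if l = i then 1 else exp ((Real.pi / k : ℝ) * I) with hv
  have hvn : ∀ l, ‖v l‖ = 1 := by
    intro l
    simp only [hv]
    split_ifs
    · simp
    · rw [norm_exp_ofReal_mul_I]
  have hv0 : ∀ l, L (v l) ≠ 0 := by
    intro l h
    have := hvn l
    rw [← L.norm_map, h, norm_zero] at this
    exact zero_ne_one this
  have hvi : v i ^ 2 = 1 := by simp [hv]
  have hvj : v j ^ 2 = ζ := by
    simp only [hv, if_neg hij.symm]
    rw [← Complex.exp_nat_mul, hζ]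
    congr 1
    push_cast
    ring
  set f : B → (EuclideanSpace ℝ (Fin 2) ≃ₗᵢ[ℝ] EuclideanSpace ℝ (Fin 2)) :=
    fun l => ((ℝ ∙ L (v l))ᗮ).reflection with hf
  have hfL : ∀ l z, f l (L z) = L (-v l ^ 2 * conj z) := fun l z =>
    reflection_orthogonal_span_complex L (hvn l) z
  have hrot : ∀ (m : ℕ) z, ((f i * f j) ^ m) (L z) = L (conj ζ ^ m * z) := by
    intro m
    induction m with
    | zero => intro z; simp
    | succ m ih =>
      intro z
      rw [pow_succ', LinearIsometryEquiv.coe_mul, Function.comp_apply, ih,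
        LinearIsometryEquiv.coe_mul, Function.comp_apply, hfL, hfL,
        hvi, hvj]
      congr 1
      simp only [map_mul, map_neg, map_pow, conj_conj]
      ring
  have hpow : (f i * f j) ^ k = 1 := by
    ext1 y
    obtain ⟨z, rfl⟩ := L.surjective y
    rw [hrot, ← map_pow, hprim.pow_eq_one, map_one, one_mul]
    rfl
  have hsq : ∀ l, f l * f l = 1 := fun l => Submodule.reflection_mul_reflection _
  have hlift : M.IsLiftable f := by
    intro a b
    rcases hall a with rfl | rfl <;> rcases hall b with rfl | rfl
    · rw [hsq, one_pow]
    · rw [hM, hpow]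
    · rw [M.symmetric, hM, ← inv_inj, ← inv_pow, mul_inv_rev, inv_one,
        inv_eq_of_mul_eq_one_left (hsq a), inv_eq_of_mul_eq_one_left (hsq b), hpow]
    · rw [hsq, one_pow]
  set cs := M.toCoxeterSystem
  set ρ := cs.lift ⟨_, hlift⟩
  have hs : ∀ l, ρ (cs.simple l) = f l := fun l => cs.lift_apply_simple hlift l
  set a := cs.simple i with ha
  set b := cs.simple j with hb
  have haa : a * a = 1 := cs.simple_mul_simple_self i
  have hab : (a * b) ^ k = 1 := by rw [← hM]; exact cs.simple_mul_simple_pow i j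
  have hbb : b * b = 1 := cs.simple_mul_simple_self j
  have hred : ∀ m : ℤ, ∃ n : ℕ, n < k ∧ (a * b) ^ m = (a * b) ^ n := by
    intro m
    have hk' : (0 : ℤ) < k := by exact_mod_cast (by omega : 0 < k)
    refine ⟨(m % k).toNat, ?_, ?_⟩
    · have := Int.emod_lt_of_pos m hk'
      have := Int.emod_nonneg m hk'.ne'
      omega
    · rw [zpow_eq_zpow_emod m (n := (k : ℤ)) (by rw [zpow_natCast, hab]), ← zpow_natCast,
        Int.toNat_of_nonneg (Int.emod_nonneg m hk'.ne')]
  have hswap : ∀ m : ℤ, a * (a * b) ^ m = (a * b) ^ (-m) * a := by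
    intro m
    have h : SemiconjBy a (a * b) (a * b)⁻¹ := by
      rw [SemiconjBy, mul_inv_rev, ← mul_assoc, haa, one_mul,
        inv_eq_of_mul_eq_one_left haa, inv_eq_of_mul_eq_one_left hbb, mul_assoc, haa, mul_one]
    rw [zpow_neg, ← inv_zpow]
    exact (h.zpow_right m).eq
  have hswap' : ∀ m : ℤ, b * (a * b) ^ m = (a * b) ^ (-(1 + m)) * a := by
    intro m
    rw [← hswap, zpow_one_add, ← mul_assoc, ← mul_assoc a a b, haa, one_mul]
  have hnf' : ∀ g : M.Group, ∃ m : ℤ, g = (a * b) ^ m ∨ g = (a * b) ^ m * a := by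
    intro g
    induction g using cs.simple_induction_left with
    | one => exact ⟨0, Or.inl (zpow_zero _).symm⟩
    | mul_simple_left g l ih =>
      obtain ⟨m, ih⟩ := ih
      rcases hall l with rfl | rfl
      · refine ⟨-m, ?_⟩
        rcases ih with rfl | rfl
        · exact Or.inr (hswap m)
        · left
          rw [← mul_assoc, hswap, mul_assoc, haa, mul_one]
      · refine ⟨-(1 + m), ?_⟩
        rcases ih with rfl | rfl
        · exact Or.inr (hswap' m)
        · left
          rw [← mul_assoc, hswap', mul_assoc, haa, mul_one]
  have hnf : ∀ g : M.Group, ∃ n : ℕ, n < k ∧ (g = (a * b) ^ n ∨ g = (a * b) ^ n * a) := by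
    intro g
    obtain ⟨m, hm⟩ := hnf' g
    obtain ⟨n, hn, h⟩ := hred m
    exact ⟨n, hn, h ▸ hm⟩
  refine ⟨2, ρ, (injective_iff_map_eq_one _).2 fun g hg => ?_, fun l => ⟨L (v l), hv0 l, hs l⟩, ?_⟩
  · obtain ⟨n, hn, rfl | rfl⟩ := hnf g
    · have h1 := hrot n 1
      rw [← hs, ← hs, ← map_mul, ← map_pow, hg] at h1
      have h2 : (1 : ℂ) = conj ζ ^ n * 1 := L.injective h1
      have h3 : ζ ^ n = 1 := by
        rw [← conj_conj (ζ ^ n), map_pow, ← mul_one (conj ζ ^ n), ← h2, map_one]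
      have h4 : n = 0 := Nat.eq_zero_of_dvd_of_lt ((hprim.pow_eq_one_iff_dvd n).1 h3) hn
      rw [h4, pow_zero]
    -- An orientation-reversing map is not the identity; testing at `1` and `I` suffices.
    · have h1 : ∀ z, z = -(conj ζ ^ n * conj z) := by
        intro z
        apply L.injective
        have h2 : ρ ((a * b) ^ n * a) (L z) = L z := by rw [hg]; rfl
        rw [map_mul, map_pow, map_mul, hs, hs, LinearIsometryEquiv.coe_mul, Function.comp_apply,
          hfL, hrot, hvi] at h2
        rw [← h2]
        congr 1
        ring
      have h3 := h1 1
      have h4 := h1 I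
      rw [map_one, mul_one] at h3
      rw [conj_I, mul_neg, neg_neg, ← neg_eq_iff_eq_neg.2 h3, neg_mul, one_mul] at h4
      exact absurd (self_eq_neg.1 h4) I_ne_zero
  · have : Finite M.Group := by
      refine Finite.of_surjective
        (fun p : Fin k × Bool => if p.2 then (a * b) ^ (p.1 : ℕ) else (a * b) ^ (p.1 : ℕ) * a) ?_
      intro g
      obtain ⟨n, hn, h | h⟩ := hnf g
      · exact ⟨(⟨n, hn⟩, true), by simp [h]⟩
      · exact ⟨(⟨n, hn⟩, false), by simp [h]⟩
    exact Set.finite_range _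

end CoxeterMatrix

end ComplexHyperbolic

/-! ### Normal forms in the affine group of type `A₂`. -/

/-- The normal form in the group with three involutive generators subject to the braid relations
of length three, that is, the affine Weyl group of type `A₂`. -/
def HasAffineA2NormalForm {G : Type*} [Group G] (a b c g : G) : Prop :=
  ∃ (m n : ℤ) (h : G), h ∈ ({1, a, b, a * b, b * a, a * b * a} : Set G) ∧
    g = (a * b * c * b) ^ m * (b * a * c * a) ^ n * h

section AffineA2

variable {G : Type*} [Group G] {a b c : G} (haa : a * a = 1) (hbb : b * b = 1) (hcc : c * c = 1)
  (hab : b * a * b = a * b * a) (hbc : c * b * c = b * c * b) (hac : c * a * c = a * c * a)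
include haa hbb hcc hab hbc hac

/-- The words `a b c b` and `b a c a` play the role of two translations generating the root lattice;
the semiconjugacies describe how `a` and `b` act on that lattice. -/
theorem affineA2_word_relations :
    Commute (a * b * c * b) (b * a * c * a) ∧
    (a * b * c * b) * (b * a * c * a) = a * b * a * c ∧
    SemiconjBy a (a * b * c * b) (a * b * c * b)⁻¹ ∧
    SemiconjBy a (b * a * c * a) ((a * b * c * b) * (b * a * c * a)) ∧
    SemiconjBy b (a * b * c * b) ((a * b * c * b) * (b * a * c * a)) ∧
    SemiconjBy b (b * a * c * a) (b * a * c * a)⁻¹ := by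
  have ia : a⁻¹ = a := inv_eq_of_mul_eq_one_left haa
  have ib : b⁻¹ = b := inv_eq_of_mul_eq_one_left hbb
  have ic : c⁻¹ = c := inv_eq_of_mul_eq_one_left hcc
  have haa' : ∀ x, a * (a * x) = x := fun x => by rw [← mul_assoc, haa, one_mul]
  have hbb' : ∀ x, b * (b * x) = x := fun x => by rw [← mul_assoc, hbb, one_mul]
  have hcc' : ∀ x, c * (c * x) = x := fun x => by rw [← mul_assoc, hcc, one_mul]
  have hab' : ∀ x, b * (a * (b * x)) = a * (b * (a * x)) := fun x => by
    simp only [← mul_assoc, hab]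
  have hbc' : ∀ x, c * (b * (c * x)) = b * (c * (b * x)) := fun x => by
    simp only [← mul_assoc, hbc]
  have hac' : ∀ x, c * (a * (c * x)) = a * (c * (a * x)) := fun x => by
    simp only [← mul_assoc, hac]
  rw [mul_assoc] at hab hbc hac
  rw [mul_assoc] at hab hbc hac
  have h1 : (a * b * c * b) * (b * a * c * a) = a * b * a * c := by
    simp only [mul_assoc, hbb', hac', haa, mul_one]
  have h2 : (b * a * c * a) * (a * b * c * b) = a * b * a * c := by
    simp only [mul_assoc, haa', hbc', hbb, mul_one, hab']
  refine ⟨h1.trans h2.symm, h1, ?_, ?_, ?_, ?_⟩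
  · simp only [SemiconjBy, mul_inv_rev, ia, ib, ic, mul_assoc, haa', haa, mul_one]
  · rw [h1]; simp only [SemiconjBy, mul_assoc]
  · rw [h1]; simp only [SemiconjBy, mul_assoc, hab']
  · simp only [SemiconjBy, mul_inv_rev, ia, ib, ic, mul_assoc, hbb', hbb, mul_one]

theorem HasAffineA2NormalForm.mul_left_a {g : G} (hg : HasAffineA2NormalForm a b c g) :
    HasAffineA2NormalForm a b c (a * g) := by
  obtain ⟨hcomm, -, hay, haz, -, -⟩ := affineA2_word_relations haa hbb hcc hab hbc hac
  obtain ⟨m, n, h, hh, rfl⟩ := hg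
  refine ⟨-m + n, n, a * h, ?_, ?_⟩
  · rcases hh with hh | hh | hh | hh | hh | hh <;> rw [hh] <;>
      simp [haa, mul_assoc, ← mul_assoc a a]
  · have h1 := (hay.zpow_right m).eq
    have h2 := (haz.zpow_right n).eq
    rw [← mul_assoc, ← mul_assoc, h1, mul_assoc _ a, h2, inv_zpow, ← zpow_neg, hcomm.mul_zpow,
      zpow_add]
    simp only [mul_assoc]

theorem HasAffineA2NormalForm.mul_left_b {g : G} (hg : HasAffineA2NormalForm a b c g) :
    HasAffineA2NormalForm a b c (b * g) := by
  obtain ⟨hcomm, -, -, -, hby, hbz⟩ := affineA2_word_relations haa hbb hcc hab hbc hac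
  obtain ⟨m, n, h, hh, rfl⟩ := hg
  have hbab : b * (a * (b * a)) = a * b := by
    rw [← mul_assoc a, ← hab, ← mul_assoc, ← mul_assoc, hbb, one_mul]
  refine ⟨m, m - n, b * h, ?_, ?_⟩
  · rw [mul_assoc] at hab
    rcases hh with hh | hh | hh | hh | hh | hh <;> rw [hh] <;>
      simp [hbb, hab, hbab, mul_assoc, ← mul_assoc b b]
  · have h1 := (hby.zpow_right m).eq
    have h2 := (hbz.zpow_right n).eq
    rw [← mul_assoc, ← mul_assoc, h1, mul_assoc _ b, h2, inv_zpow, ← zpow_neg, hcomm.mul_zpow,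
      sub_eq_add_neg, zpow_add]
    simp only [mul_assoc]

/-- The product of the two translation words is `a b a c`, so `c` is `a b a` times a translation and
the cases of `a` and `b` apply. -/
theorem HasAffineA2NormalForm.mul_left_c {g : G} (hg : HasAffineA2NormalForm a b c g) :
    HasAffineA2NormalForm a b c (c * g) := by
  obtain ⟨hcomm, hyz, -, -, -, -⟩ := affineA2_word_relations haa hbb hcc hab hbc hac
  have hc : c * g = a * (b * (a * ((a * b * c * b) * (b * a * c * a) * g))) := by
    rw [hyz]
    simp only [← mul_assoc]
    rw [mul_assoc (a * b) a a, haa, mul_one, mul_assoc a b b, hbb, mul_one, haa, one_mul]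
  rw [hc]
  refine .mul_left_a haa hbb hcc hab hbc hac (.mul_left_b haa hbb hcc hab hbc hac
    (.mul_left_a haa hbb hcc hab hbc hac ?_))
  obtain ⟨m, n, h, hh, rfl⟩ := hg
  refine ⟨1 + m, 1 + n, h, hh, ?_⟩
  have key : ∀ y z : G, Commute y z →
      y * z * (y ^ m * z ^ n * h) = y ^ (1 + m) * z ^ (1 + n) * h := by
    intro y z hyz
    have := (hyz.zpow_left m).eq
    rw [zpow_one_add, zpow_one_add]
    simp only [mul_assoc]
    rw [← mul_assoc z, ← this]
    simp only [mul_assoc]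
  exact key _ _ hcomm

end AffineA2

/-! ### Affine reflections in coordinates. -/

section AffineReflections

theorem reflection_apply_of_direction_eq {E : Type*} [NormedAddCommGroup E]
    [InnerProductSpace ℝ E] {s : AffineSubspace ℝ E} [Nonempty s]
    [s.direction.HasOrthogonalProjection] {p v : E} (hp : p ∈ s) (hs : s.direction = (ℝ ∙ v)ᗮ)
    (y : E) :
    EuclideanGeometry.reflection s y = y - (2 * (inner ℝ v (y - p) / ‖v‖ ^ 2)) • v := by
  rw [EuclideanGeometry.reflection_apply_of_mem _ _ hp]
  simp only [hs]
  rw [Submodule.reflection_orthogonal_apply, Submodule.reflection_singleton_apply, vsub_eq_sub,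
    vadd_eq_add, two_smul, mul_smul, two_smul]
  simp only [RCLike.ofReal_real_eq_id, id]
  abel

/-- The vector `e_p - e_q`. -/
noncomputable def rootA (p q : Fin 3) : EuclideanSpace ℝ (Fin 3) :=
  EuclideanSpace.single p 1 - EuclideanSpace.single q 1

/-- The hyperplane `x_p - x_q = d`. -/
noncomputable def hyperplaneA (p q : Fin 3) (d : ℝ) :
    AffineSubspace ℝ (EuclideanSpace ℝ (Fin 3)) :=
  AffineSubspace.mk' (EuclideanSpace.single p d) (ℝ ∙ rootA p q)ᗮ

instance (p q : Fin 3) (d : ℝ) : Nonempty (hyperplaneA p q d) :=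
  ⟨⟨_, AffineSubspace.self_mem_mk' _ _⟩⟩

theorem rootA_ne_zero {p q : Fin 3} (hpq : p ≠ q) : rootA p q ≠ 0 := by
  intro h
  have := congrArg (fun x => x p) h
  simp [rootA, hpq] at this

theorem finrank_direction_hyperplaneA {p q : Fin 3} (hpq : p ≠ q) (d : ℝ) :
    Module.finrank ℝ (hyperplaneA p q d).direction + 1 = 3 := by
  have : Fact (Module.finrank ℝ (EuclideanSpace ℝ (Fin 3)) = 2 + 1) := ⟨by simp⟩
  rw [hyperplaneA, AffineSubspace.direction_mk',
    Submodule.finrank_orthogonal_span_singleton (n := 2) (rootA_ne_zero hpq)]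

/-- The reflection in the hyperplane `x_p - x_q = d`. -/
noncomputable def reflectionA (p q : Fin 3) (d : ℝ) :
    EuclideanSpace ℝ (Fin 3) ≃ᵃⁱ[ℝ] EuclideanSpace ℝ (Fin 3) :=
  EuclideanGeometry.reflection (hyperplaneA p q d)

theorem reflectionA_apply {p q : Fin 3} (hpq : p ≠ q) (d : ℝ) (y : EuclideanSpace ℝ (Fin 3)) :
    reflectionA p q d y = y - (y p - y q - d) • rootA p q := by
  have hn : ‖rootA p q‖ ^ 2 = 2 := by
    rw [← real_inner_self_eq_norm_sq, rootA, inner_sub_left, EuclideanSpace.inner_single_left,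
      EuclideanSpace.inner_single_left]
    simp [hpq, hpq.symm]
    norm_num
  have hi : inner ℝ (rootA p q) (y - EuclideanSpace.single p d) = y p - y q - d := by
    rw [rootA, inner_sub_left, EuclideanSpace.inner_single_left,
      EuclideanSpace.inner_single_left]
    simp [hpq.symm]
    ring
  rw [reflectionA, reflection_apply_of_direction_eq (s := hyperplaneA p q d)
    (AffineSubspace.self_mem_mk' _ _)
    (AffineSubspace.direction_mk' _ _), hn, hi]
  congr 2
  ring

theorem reflectionA_mul_self (p q : Fin 3) (d : ℝ) : reflectionA p q d * reflectionA p q d = 1 := by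
  ext1 y
  rw [AffineIsometryEquiv.coe_mul, Function.comp_apply, reflectionA,
    EuclideanGeometry.reflection_reflection, AffineIsometryEquiv.coe_one, id]

theorem reflectionA_01 (x y z : ℝ) : reflectionA 0 1 0 !₂[x, y, z] = !₂[y, x, z] := by
  rw [reflectionA_apply (by decide)]
  ext t
  fin_cases t <;> simp [rootA]

theorem reflectionA_12 (x y z : ℝ) : reflectionA 1 2 0 !₂[x, y, z] = !₂[x, z, y] := by
  rw [reflectionA_apply (by decide)]
  ext t
  fin_cases t <;> simp [rootA]

theorem reflectionA_02 (x y z : ℝ) : reflectionA 0 2 1 !₂[x, y, z] = !₂[z + 1, y, x - 1] := by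
  rw [reflectionA_apply (by decide)]
  ext t
  fin_cases t <;> simp [rootA] <;> ring

theorem eq_vec3 (p : EuclideanSpace ℝ (Fin 3)) : p = !₂[p 0, p 1, p 2] := by
  ext t
  fin_cases t <;> rfl

theorem affineIsometry_ext_vec3
    {f g : EuclideanSpace ℝ (Fin 3) ≃ᵃⁱ[ℝ] EuclideanSpace ℝ (Fin 3)}
    (h : ∀ x y z : ℝ, f !₂[x, y, z] = g !₂[x, y, z]) : f = g := by
  ext1 p
  rw [eq_vec3 p]
  exact h _ _ _

section Coordinates

variable {r₁ r₂ r₃ : EuclideanSpace ℝ (Fin 3) ≃ᵃⁱ[ℝ] EuclideanSpace ℝ (Fin 3)}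
  (h₁ : ∀ x y z : ℝ, r₁ !₂[x, y, z] = !₂[y, x, z])
  (h₂ : ∀ x y z : ℝ, r₂ !₂[x, y, z] = !₂[x, z, y])
  (h₃ : ∀ x y z : ℝ, r₃ !₂[x, y, z] = !₂[z + 1, y, x - 1])
include h₁ h₂ h₃

theorem affineA2_mul_pow_three : (r₁ * r₂) ^ 3 = 1 ∧ (r₂ * r₃) ^ 3 = 1 ∧ (r₁ * r₃) ^ 3 = 1 := by
  refine ⟨?_, ?_, ?_⟩ <;> refine affineIsometry_ext_vec3 fun x y z => ?_ <;>
    simp [pow_succ, h₁, h₂, h₃]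

theorem affineA2_translation_apply (p : EuclideanSpace ℝ (Fin 3)) :
    (r₁ * r₂ * r₃ * r₂) p = p + !₂[-1, 1, 0] ∧ (r₂ * r₁ * r₃ * r₁) p = p + !₂[0, -1, 1] := by
  rw [eq_vec3 p]
  simp only [AffineIsometryEquiv.coe_mul, Function.comp_apply, h₁, h₂, h₃]
  constructor <;> ext t <;> fin_cases t <;> simp <;> ring

-- The elements listed permute coordinates, hence fix the origin; `(0, 1, 2)` has distinct
-- coordinates and is moved by every nontrivial permutation.
omit h₃ in
theorem affineA2_linear_part {G : Type*} [Group G]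
    (ρ : G →* (EuclideanSpace ℝ (Fin 3) ≃ᵃⁱ[ℝ] EuclideanSpace ℝ (Fin 3))) {a b h : G}
    (ha : ρ a = r₁) (hb : ρ b = r₂) (hh : h ∈ ({1, a, b, a * b, b * a, a * b * a} : Set G)) :
    ρ h 0 = 0 ∧ (ρ h !₂[0, 1, 2] = !₂[0, 1, 2] → h = 1) := by
  have h0 : (0 : EuclideanSpace ℝ (Fin 3)) = !₂[0, 0, 0] := eq_vec3 0
  rcases hh with rfl | rfl | rfl | rfl | rfl | rfl
  · simp
  all_goals
    rw [h0]
    simp only [map_mul, ha, hb, AffineIsometryEquiv.coe_mul, Function.comp_apply, h₁, h₂, true_and]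
    intro hp
    exfalso
    have h0 := congrArg (fun x => x 0) hp
    have h1 := congrArg (fun x => x 1) hp
    simp at h0 h1

end Coordinates

theorem zpow_apply_of_translation {E : Type*} [NormedAddCommGroup E] [NormedSpace ℝ E]
    {T : E ≃ᵃⁱ[ℝ] E} {v : E} (hT : ∀ p, T p = p + v) (m : ℤ) (p : E) :
    (T ^ m) p = p + (m : ℝ) • v := by
  induction m with
  | zero => simp
  | succ n ih =>
    rw [add_comm, zpow_one_add, AffineIsometryEquiv.coe_mul, Function.comp_apply, ih, hT]
    push_cast
    rw [add_smul, one_smul]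
    abel
  | pred n ih =>
    have h : T ((T ^ (-(n : ℤ) - 1)) p) = (T ^ (-(n : ℤ))) p := by
      rw [show -(n : ℤ) = 1 + (-(n : ℤ) - 1) by ring, zpow_one_add, AffineIsometryEquiv.coe_mul,
        Function.comp_apply]
      simp
    rw [hT, ih] at h
    rw [eq_sub_of_add_eq h]
    push_cast
    rw [sub_smul, one_smul]
    abel

end AffineReflections

/-! ### The triangle with all labels `3` is Euclidean. -/

namespace CoxeterMatrix

variable {B : Type*} (M : CoxeterMatrix B)

/-- The Coxeter matrix of type `A₂` affine is of Euclidean type. -/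
theorem isEuclideanType_of_triple {i j l : B} (hij : i ≠ j) (hil : i ≠ l) (hjl : j ≠ l)
    (hall : ∀ t, t = i ∨ t = j ∨ t = l) (hM : ∀ s t, s ≠ t → M s t = 3) :
    M.IsEuclideanType := by
  classical
  obtain ⟨r₁, hr₁⟩ : ∃ r, r = reflectionA 0 1 0 := ⟨_, rfl⟩
  obtain ⟨r₂, hr₂⟩ : ∃ r, r = reflectionA 1 2 0 := ⟨_, rfl⟩
  obtain ⟨r₃, hr₃⟩ : ∃ r, r = reflectionA 0 2 1 := ⟨_, rfl⟩
  have hc₁ : ∀ x y z : ℝ, r₁ !₂[x, y, z] = !₂[y, x, z] := hr₁ ▸ reflectionA_01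
  have hc₂ : ∀ x y z : ℝ, r₂ !₂[x, y, z] = !₂[x, z, y] := hr₂ ▸ reflectionA_12
  have hc₃ : ∀ x y z : ℝ, r₃ !₂[x, y, z] = !₂[z + 1, y, x - 1] := hr₃ ▸ reflectionA_02
  set f : B → (EuclideanSpace ℝ (Fin 3) ≃ᵃⁱ[ℝ] EuclideanSpace ℝ (Fin 3)) := fun t =>
    if t = i then r₁ else if t = j then r₂ else r₃ with hf
  have hfi : f i = r₁ := by simp [hf]
  have hfj : f j = r₂ := by simp [hf, hij.symm]
  have hfl : f l = r₃ := by simp [hf, hil.symm, hjl.symm]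
  have hsq : ∀ t, f t * f t = 1 := by
    intro t
    rcases hall t with rfl | rfl | rfl
    · rw [hfi, hr₁, reflectionA_mul_self]
    · rw [hfj, hr₂, reflectionA_mul_self]
    · rw [hfl, hr₃, reflectionA_mul_self]
  have hinv : ∀ s t, (f s * f t) ^ 3 = 1 → (f t * f s) ^ 3 = 1 := by
    intro s t h
    rw [← inv_inj, ← inv_pow, mul_inv_rev, inv_one, inv_eq_of_mul_eq_one_left (hsq s),
      inv_eq_of_mul_eq_one_left (hsq t), h]
  obtain ⟨h₁, h₂, h₃⟩ := affineA2_mul_pow_three hc₁ hc₂ hc₃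
  rw [← hfi, ← hfj] at h₁
  rw [← hfj, ← hfl] at h₂
  rw [← hfi, ← hfl] at h₃
  have hlift : M.IsLiftable f := by
    intro s t
    by_cases hst : s = t
    · rw [hst, hsq, one_pow]
    rw [hM s t hst]
    rcases hall s with rfl | rfl | rfl <;> rcases hall t with rfl | rfl | rfl <;>
      first
        | exact absurd rfl hst
        | assumption
        | exact hinv _ _ (by assumption)
  set cs := M.toCoxeterSystem
  set ρ := cs.lift ⟨_, hlift⟩
  have hs : ∀ t, ρ (cs.simple t) = f t := fun t => cs.lift_apply_simple hlift t
  set a := cs.simple i with ha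
  set b := cs.simple j with hb
  set c := cs.simple l with hc
  have haa : a * a = 1 := cs.simple_mul_simple_self i
  have hbb : b * b = 1 := cs.simple_mul_simple_self j
  have hcc : c * c = 1 := cs.simple_mul_simple_self l
  have hbraid : ∀ s t, s ≠ t → cs.simple s * cs.simple t * cs.simple s
      = cs.simple t * cs.simple s * cs.simple t := by
    intro s t hst
    have h := cs.simple_mul_simple_pow s t
    rw [hM s t hst] at h
    rw [← mul_inv_eq_one, mul_inv_rev, mul_inv_rev, cs.inv_simple, cs.inv_simple, ← h]
    simp only [pow_succ, pow_zero, one_mul, mul_assoc]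
  have hab := hbraid j i hij.symm
  have hbc := hbraid l j hjl.symm
  have hac := hbraid l i hil.symm
  have hnf : ∀ g : M.Group, HasAffineA2NormalForm a b c g := by
    intro g
    induction g using cs.simple_induction_left with
    | one => exact ⟨0, 0, 1, by simp, by simp⟩
    | mul_simple_left g t ih =>
      rcases hall t with rfl | rfl | rfl
      · exact ih.mul_left_a haa hbb hcc hab hbc hac
      · exact ih.mul_left_b haa hbb hcc hab hbc hac
      · exact ih.mul_left_c haa hbb hcc hab hbc hac
  have hρa : ρ a = r₁ := (hs i).trans hfi
  have hρb : ρ b = r₂ := (hs j).trans hfj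
  have hρc : ρ c = r₃ := (hs l).trans hfl
  have hy : ∀ p, ρ (a * b * c * b) p = p + !₂[-1, 1, 0] := by
    intro p
    rw [map_mul, map_mul, map_mul, hρa, hρb, hρc]
    exact (affineA2_translation_apply hc₁ hc₂ hc₃ p).1
  have hz : ∀ p, ρ (b * a * c * a) p = p + !₂[0, -1, 1] := by
    intro p
    rw [map_mul, map_mul, map_mul, hρa, hρb, hρc]
    exact (affineA2_translation_apply hc₁ hc₂ hc₃ p).2
  have hD0 : ∀ h ∈ ({1, a, b, a * b, b * a, a * b * a} : Set M.Group), ρ h 0 = 0 :=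
    fun h hh => (affineA2_linear_part hc₁ hc₂ ρ hρa hρb hh).1
  have hD1 : ∀ h ∈ ({1, a, b, a * b, b * a, a * b * a} : Set M.Group),
      ρ h !₂[0, 1, 2] = !₂[0, 1, 2] → h = 1 :=
    fun h hh => (affineA2_linear_part hc₁ hc₂ ρ hρa hρb hh).2
  have hform : ∀ (m n : ℤ) (h : M.Group) p, ρ ((a * b * c * b) ^ m * (b * a * c * a) ^ n * h) p
      = ρ h p + (n : ℝ) • !₂[0, -1, 1] + (m : ℝ) • !₂[-1, 1, 0] := by
    intro m n h p
    rw [map_mul, map_mul, map_zpow, map_zpow, AffineIsometryEquiv.coe_mul, Function.comp_apply,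
      AffineIsometryEquiv.coe_mul, Function.comp_apply, zpow_apply_of_translation hy,
      zpow_apply_of_translation hz]
  refine ⟨3, ρ, (injective_iff_map_eq_one _).2 fun g hg => ?_, fun t => ?_, fun K hK => ?_⟩
  · obtain ⟨m, n, h, hh, rfl⟩ := hnf g
    have h1 := hform m n h 0
    rw [hg, hD0 h hh] at h1
    have hm : m = 0 := by simpa using congrArg (fun x => x 0) h1
    have hn : n = 0 := by simpa [eq_comm] using congrArg (fun x => x 2) h1
    rw [hm, hn, zpow_zero, zpow_zero, one_mul, one_mul] at hg ⊢
    exact hD1 h hh (by rw [hg, AffineIsometryEquiv.coe_one, id])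
  · have hst : ρ (M.simple t) = f t := hs t
    rw [hst]
    rcases hall t with rfl | rfl | rfl
    · exact ⟨hyperplaneA 0 1 0, inferInstance, finrank_direction_hyperplaneA (by decide) _,
        hfi.trans hr₁⟩
    · exact ⟨hyperplaneA 1 2 0, inferInstance, finrank_direction_hyperplaneA (by decide) _,
        hfj.trans hr₂⟩
    · exact ⟨hyperplaneA 0 2 1, inferInstance, finrank_direction_hyperplaneA (by decide) _,
        hfl.trans hr₃⟩
  · obtain ⟨R, hR⟩ := hK.isBounded.exists_norm_le
    have hcoord : ∀ (p : EuclideanSpace ℝ (Fin 3)) t, ‖p‖ ≤ R → |p t| ≤ R := fun p t hp =>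
      (PiLp.norm_apply_le p t).trans hp
    -- The part `h` fixes the origin, so `h p` and its translate both have norm at most `R`. Their
    -- coordinates `0` and `2` differ by `m` and `n` up to sign, which bounds both by `2 * R`.
    set N := ⌈2 * R⌉
    refine Set.Finite.subset (((Set.finite_Icc (-N) N).prod ((Set.finite_Icc (-N) N).prod
      (Set.toFinite ({1, a, b, a * b, b * a, a * b * a} : Set M.Group)))).image
        fun q => ρ ((a * b * c * b) ^ q.1 * (b * a * c * a) ^ q.2.1 * q.2.2)) ?_
    rintro _ ⟨⟨g, rfl⟩, _, ⟨p, hp, rfl⟩, hgp⟩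
    obtain ⟨m, n, h, hh, rfl⟩ := hnf g
    have hbd : ∀ r : ℤ, |(r : ℝ)| ≤ 2 * R → r ∈ Set.Icc (-N) N := by
      intro r hr
      rw [abs_le] at hr
      have := Int.le_ceil (2 * R)
      constructor
      · have : (-N : ℝ) ≤ r := by linarith [hr.1]
        exact_mod_cast this
      · have : (r : ℝ) ≤ N := by linarith [hr.2]
        exact_mod_cast this
    have hn : ‖ρ h p‖ ≤ R := by
      have := (ρ h).dist_map p 0
      rw [hD0 h hh, dist_zero_right, dist_zero_right] at this
      rw [this]
      exact hR p hp
    have hq := hform m n h p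
    obtain ⟨q, hqp⟩ : ∃ q, q = ρ ((a * b * c * b) ^ m * (b * a * c * a) ^ n * h) p := ⟨_, rfl⟩
    rw [← hqp] at hgp hq
    have hg := hR _ hgp
    have e0 : q 0 = ρ h p 0 - m := by rw [hq]; simp; ring
    have e2 : q 2 = ρ h p 2 + n := by rw [hq]; simp
    have b0 := abs_le.1 (hcoord _ 0 hn)
    have b2 := abs_le.1 (hcoord _ 2 hn)
    have c0 := abs_le.1 (hcoord _ 0 hg)
    have c2 := abs_le.1 (hcoord _ 2 hg)
    refine ⟨(m, n, h), ⟨hbd m ?_, hbd n ?_, hh⟩, rfl⟩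
    · rw [abs_le]; constructor <;> linarith
    · rw [abs_le]; constructor <;> linarith

end CoxeterMatrix

/-! ### Numerical consequences of being infinite non-affine. -/

namespace CoxeterMatrix

variable {B : Type*} (M : CoxeterMatrix B)

theorem isSphericalType_of_card_le_two [Fintype B] [Nonempty B] (hB : Fintype.card B ≤ 2) {k : ℕ}
    (hk : 2 ≤ k) (hM : ∀ i j, i ≠ j → M i j = k) : M.IsSphericalType := by
  have h0 : 0 < Fintype.card B := Fintype.card_pos
  rcases (by omega : Fintype.card B = 1 ∨ Fintype.card B = 2) with h | h
  · obtain ⟨i, hi⟩ := Fintype.card_eq_one_iff.1 h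
    exact M.isSphericalType_of_subsingleton hi
  · rw [← Nat.card_eq_fintype_card, Nat.card_eq_two_iff] at h
    obtain ⟨i, j, hij, huniv⟩ := h
    exact M.isSphericalType_of_pair hij (fun l => by simpa using huniv.ge (Set.mem_univ l)) hk
      (hM i j hij)

theorem isEuclideanType_of_card_eq_three [Fintype B] (hB : Fintype.card B = 3)
    (hM : ∀ i j, i ≠ j → M i j = 3) : M.IsEuclideanType := by
  classical
  obtain ⟨i, j, l, hij, hil, hjl, huniv⟩ := Finset.card_eq_three.1 (Finset.card_univ.trans hB)
  exact M.isEuclideanType_of_triple hij hil hjl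
    (fun t => by simpa using huniv.le (Finset.mem_univ t)) hM

/-- If the bounds fail, each component either has at most two vertices (always so when `k = 2`,
where components are singletons) or is the affine triangle. -/
theorem IsInfiniteNonaffine.rank_and_label_bounds [Fintype B] {M : CoxeterMatrix B}
    (h : M.IsInfiniteNonaffine) {k : ℕ} (hk : 2 ≤ k) (hM : ∀ i j, i ≠ j → M i j = k) :
    3 ≤ Fintype.card B ∧ 3 ≤ k ∧ (4 ≤ Fintype.card B ∨ 4 ≤ k) := by
  classical
  by_contra hcon
  refine h fun c => ?_
  have hMc : ∀ i j : c.supp, i ≠ j → M.restrictTo c.supp i j = k :=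
    fun i j hij => hM i.1 j.1 fun h' => hij (Subtype.ext h')
  have hne : Nonempty c.supp := c.nonempty_supp.to_subtype
  have hle : Fintype.card c.supp ≤ Fintype.card B := Fintype.card_subtype_le _
  by_cases hc : Fintype.card c.supp ≤ 2
  · exact Or.inl (isSphericalType_of_card_le_two _ hc hk hMc)
  by_cases hk2 : k = 2
  · have hbot : M.coxeterGraph = ⊥ := by
      ext i j
      simp only [coxeterGraph, SimpleGraph.bot_adj, iff_false, not_and, not_not]
      exact fun hij => (hM i j hij).trans hk2
    have : Subsingleton c.supp := by
      have hr : ∀ x y, M.coxeterGraph.Reachable x y → x = y := fun x y hxy => by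
        rwa [hbot, SimpleGraph.reachable_bot] at hxy
      exact ⟨fun i j => Subtype.ext (hr _ _
        (SimpleGraph.ConnectedComponent.exact (i.2.trans j.2.symm)))⟩
    have := Fintype.card_le_one_iff_subsingleton.2 this
    omega
  · refine Or.inr (isEuclideanType_of_card_eq_three _ (by omega) ?_)
    rwa [show k = 3 by omega] at hMc

end CoxeterMatrix

/-- For `N ≥ 2` the value `cos (π / 3) = 1 / 2` already suffices. For `N = 1` the cosine must exceed
`5 / 8`, which `√2 / 2` does and `1 / 2`, the affine triangle, does not. -/
theorem twistedForm_negVector_bound {N k : ℕ} (hN : 1 ≤ N) (hk : 3 ≤ k) (h : 2 ≤ N ∨ 4 ≤ k) :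
    (N + 4 - Real.cos (Real.pi / k) * (N ^ 2 + 3 * N + 4) : ℝ) < 0 := by
  have hcos : ∀ m : ℕ, 0 < m → m ≤ k → Real.cos (Real.pi / m) ≤ Real.cos (Real.pi / k) := by
    intro m hm hmk
    have hm' : (1 : ℝ) ≤ m := by exact_mod_cast hm
    have hmk' : (m : ℝ) ≤ k := by exact_mod_cast hmk
    exact Real.cos_le_cos_of_nonneg_of_le_pi (div_nonneg Real.pi_pos.le (by linarith))
      (div_le_self Real.pi_pos.le hm')
      (div_le_div_of_nonneg_left Real.pi_pos.le (by linarith) hmk')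
  have hN' : (1 : ℝ) ≤ N := by exact_mod_cast hN
  by_cases hN2 : 2 ≤ N
  · have hN2' : (2 : ℝ) ≤ N := by exact_mod_cast hN2
    have h3 := hcos 3 (by norm_num) hk
    rw [Nat.cast_ofNat, Real.cos_pi_div_three] at h3
    nlinarith
  · have hN1 : (N : ℝ) = 1 := by exact_mod_cast (by omega : N = 1)
    have h4 := hcos 4 (by norm_num) (h.resolve_left hN2)
    rw [Nat.cast_ofNat, Real.cos_pi_div_four] at h4
    have : (5 / 4 : ℝ) < √2 := Real.lt_sqrt_of_sq_lt (by norm_num)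
    rw [hN1]
    nlinarith

theorem mainTheorem7 {B : Type*} [Fintype B] {W : Type*} [Group W] {M : CoxeterMatrix B}
    (cs : CoxeterSystem M W) (hM : M.IsSingleBraided) (hina : M.IsInfiniteNonaffine)
    (hexc : ¬ (Fintype.card B = 3 ∧ ∀ i j : B, i ≠ j → M i j = 4))
    (w : W) (hw : cs.IsCoxeterElement w) :
    Filter.Tendsto (fun n : ℕ => cs.reflectionLength (w ^ n)) Filter.atTop Filter.atTop := by
  obtain ⟨k, hk, hMk⟩ := hM
  obtain ⟨hB, hk3, hBk⟩ := hina.rank_and_label_bounds hk hMk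
  obtain ⟨σ, rfl⟩ := hw
  obtain ⟨C, hC, hCn⟩ : ∃ C : ℝ, 0 < C ∧ ∀ n : ℕ,
      C * n ≤ cs.reflectionLength (cs.wordProd (List.ofFn σ) ^ n) := by
    clear hexc
    generalize Fintype.card B = m at σ hB hBk
    obtain ⟨N, rfl⟩ : ∃ N, m = N + 2 := ⟨m - 2, by omega⟩
    exact cs.exists_linear_le_reflectionLength_coxeterElement_pow (by omega) hk3 hMk
      (twistedForm_negVector_bound (by omega) hk3 (hBk.imp_left (by omega))) σ
  refine Filter.tendsto_atTop.2 fun b => ?_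
  filter_upwards [Filter.eventually_ge_atTop ⌈b / C⌉₊] with n hn
  have h1 : (b : ℝ) / C ≤ n := (Nat.le_ceil _).trans (by exact_mod_cast hn)
  rw [div_le_iff₀ hC] at h1
  have h2 := hCn n
  exact_mod_cast (by linarith : (b : ℝ) ≤ cs.reflectionLength (cs.wordProd (List.ofFn σ) ^ n))
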